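/- Let $n,N\ge 0$ and $m\ge 1$ be integers, let $A_1,\dots,A_N\in\mathbb R^{n\times n}$, and let $(\Omega,\mathcal M,P)$ be a probability space. For every initial mode $s\in\{1,\dots,N\}$ let $\{\sigma_k\}_{k\ge0}$, $\{t_k\}_{k\ge0}$, $\{J_k\}_{k\ge0}$ be stochastic processes on $\Omega$ with values in $\{1,\dots,N\}$, $\mathbb R_+$ and $\mathbb R^{n\times n}$, with $\sigma_0=s$, $t_0=0$ and $t_k$ nondecreasing in $k$ (the dependence on $s$ is suppressed). Put $h_k=t_{k+1}-t_k$, and consider the switched system $$\Sigma:\quad \frac{dx}{dt}=A_{\sigma_k}x(t)\ \ (t_k\le t<t_{k+1}),\qquad x(t_{k+1})=J_k\,x(t_{k+1}^-)\ \ (k\ge0),\qquad x(0)=x_0\in\mathbb R^n,$$ where trajectories are required to satisfy these equations almost surely. Assume that $\Sigma$ is a positive semi-Markovian jump linear system, i.e. for all $i,j\in\{1,\dots,N\}$, $u\ge0$ and Borel sets $B\subset\mathbb R^{n\times n}$: 1. (Markovian property) for every initial mode and every $k\ge 0$, almost surely $$P(\sigma_{k+1}=j,h_k\le u,J_k\in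 B\mid\sigma_k,\dots,\sigma_0,t_k,\dots,t_0,J_{k-1},\dots,J_0)=P(\sigma_{k+1}=j,h_k\le u,J_k\in B\mid\sigma_k);$$ 2. (time homogeneity) $P(\sigma_{k+1}=j,h_k\le u,J_k\in B\mid\sigma_k=i)$ depends neither on $k$ nor on the initial mode (among those for which $P(\sigma_k=i)\ne0$); 3. (positivity) each $A_i$ is Metzler (its off-diagonal entries are nonnegative) and each $J_k$ is entrywise nonnegative almost surely. Assume moreover that there are $T,R>0$ such that, almost surely, $0<h_k\le T$ and $\|J_k\|\le R$ for every $k\ge0$ and every initial mode. Let $p_{ij}=P(\sigma_{k+1}=j\mid\sigma_k=i)$. For $x\in\mathbb R^n$ let $x^{[m]}\in\mathbb R^{n_m}$, $n_m=\binom{n+m-1}{m}$, be the vector of all the monomials of degree $m$ in $x_1,\dots,x_n$, where $x_1^{d_1}\cdots x_n^{d_n}$ carries the coefficient $\sqrt{m!/(d_1!\cdots d_n!)}$, so that $\|x^{[m]}\|_2=\|x\|_2^m$; for $A\in\mathbb R^{n\times n}$ let $A^{[m]}\in\mathbb R^{n_m\times n_m}$ be the unique matrix with $(Ax)^{[m]}=A^{[m]}x^{[m]}$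 for all $x\in\mathbb R^n$. Call $\Sigma$ exponentially $m$-th mean stable if there are $C>0$ and $\beta>0$ such that, for every initial state $x_0$, every initial mode $\sigma_0$ and every $t\ge0$, the trajectory satisfies $E[\|x(t)\|^m]\le Ce^{-\beta t}\|x_0\|^m$ (with the Euclidean norm, or equivalently any other norm). Then $\Sigma$ is exponentially $m$-th mean stable if and only if the block matrix $\mathcal A_m(\Sigma)\in\mathbb R^{(n_mN)\times(n_mN)}$ with $(i,j)$-block $$[\mathcal A_m(\Sigma)]_{ij}=p_{ji}\,E\big[(J_ke^{A_{\sigma_k}h_k})^{[m]}\,\big|\,\sigma_k=j,\ \sigma_{k+1}=i\big]\in\mathbb R^{n_m\times n_m}$$ (which by time homogeneity does not depend on $k$, and is read as $0$ if $p_{ji}=0$) is Schur stable, i.e. has spectral radius less than $1$. -/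

import Mathlib

open MeasureTheory ProbabilityTheory Filter Topology
open scoped ENNReal

namespace SMJLS

noncomputable section

/-- Real matrices carry the Borel `σ`-algebra of their usual topology. -/
instance matrixMeasurableSpace (n : ℕ) : MeasurableSpace (Matrix (Fin n) (Fin n) ℝ) :=
  borel _

instance matrixBorelSpace (n : ℕ) : BorelSpace (Matrix (Fin n) (Fin n) ℝ) := ⟨rfl⟩

/-- Exponent vectors of the monomials of degree `m` in `n` variables; they index the coordinates
of `x^[m]`. -/
abbrev Mon (n m : ℕ) : Type := {d : Fin n → ℕ // d ∈ Finset.piAntidiag Finset.univ m}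

/-- There are `n_m = (n + m - 1 choose m)` monomials. -/
theorem card_mon (n m : ℕ) : Fintype.card (Mon n m) = (n + m - 1).choose m := by
  rw [Fintype.card_coe, ← Finset.map_sym_eq_piAntidiag, Finset.card_map, Finset.sym_univ,
    Finset.card_univ, Sym.card_sym_eq_multichoose, Nat.multichoose_eq, Fintype.card_fin]

/-- The vector `x^[m]`: the monomials of degree `m`, the monomial `x^d` with coefficient
`√(m! / (d₁! ⋯ dₙ!))`. -/
def powVec {n : ℕ} (m : ℕ) (x : Fin n → ℝ) : Mon n m → ℝ :=
  fun d => √(Nat.multinomial Finset.univ d.1 : ℝ) * ∏ i, x i ^ d.1 i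

/-- The coefficients are those for which `‖x^[m]‖₂ = ‖x‖₂ ^ m`. -/
theorem norm_powVec {n : ℕ} (m : ℕ) (x : Fin n → ℝ) :
    ‖(WithLp.toLp 2 (powVec m x) : EuclideanSpace ℝ (Mon n m))‖ =
      ‖(WithLp.toLp 2 x : EuclideanSpace ℝ (Fin n))‖ ^ m := by
  rw [← sq_eq_sq₀ (norm_nonneg _) (by positivity), ← pow_mul, mul_comm m 2, pow_mul,
    EuclideanSpace.real_norm_sq_eq, EuclideanSpace.real_norm_sq_eq,
    Finset.sum_pow_eq_sum_piAntidiag,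
    ← Finset.sum_coe_sort (Finset.piAntidiag Finset.univ m)]
  refine Finset.sum_congr rfl fun d _ => ?_
  simp only [powVec, mul_pow, Real.sq_sqrt (Nat.cast_nonneg _), ← Finset.prod_pow]
  congr 1
  refine Finset.prod_congr rfl fun i _ => ?_
  rw [← pow_mul, ← pow_mul, mul_comm]

/-- The matrix `A^[m]`, that is, the unique matrix with `(A x)^[m] = A^[m] x^[m]` for all `x`
(see `powMat_mulVec` and `powMat_unique`). Its `(a, b)` entry is the coefficient of `X ^ b` in
`∏ i, (∑ j, A i j X j) ^ a i`, rescaled by the coefficients of `x^[m]`. -/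
def powMat {n : ℕ} (m : ℕ) (A : Matrix (Fin n) (Fin n) ℝ) : Matrix (Mon n m) (Mon n m) ℝ :=
  Matrix.of fun a b =>
    √(Nat.multinomial Finset.univ a.1 : ℝ) / √(Nat.multinomial Finset.univ b.1 : ℝ) *
      MvPolynomial.coeff (Finsupp.equivFunOnFinite.symm b.1)
        (∏ i, (∑ j, MvPolynomial.C (A i j) * MvPolynomial.X j) ^ a.1 i)

theorem powMat_mulVec {n : ℕ} (m : ℕ) (A : Matrix (Fin n) (Fin n) ℝ) (x : Fin n → ℝ) :
    powVec m (A.mulVec x) = (powMat m A).mulVec (powVec m x) := by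
  ext a
  set p : MvPolynomial (Fin n) ℝ :=
    ∏ i, (∑ j, MvPolynomial.C (A i j) * MvPolynomial.X j) ^ a.1 i with hp
  have hhom : p.IsHomogeneous m := by
    have h1 : p.IsHomogeneous (∑ i, 1 * a.1 i) := by
      refine MvPolynomial.IsHomogeneous.prod _ _ _ fun i _ => ?_
      refine MvPolynomial.IsHomogeneous.pow ?_ _
      refine MvPolynomial.IsHomogeneous.sum _ _ _ fun j _ => ?_
      simpa using (MvPolynomial.isHomogeneous_C (Fin n) (A i j)).mul
        (MvPolynomial.isHomogeneous_X ℝ j)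
    have h2 : ∑ i, 1 * a.1 i = m := by
      simpa using (Finset.mem_piAntidiag.1 a.2).1
    rwa [h2] at h1
  have heval : MvPolynomial.eval x p = ∏ i, (A.mulVec x) i ^ a.1 i := by
    simp [hp, Matrix.mulVec, dotProduct]
  have hsum : MvPolynomial.eval x p =
      ∑ b : Mon n m, MvPolynomial.coeff (Finsupp.equivFunOnFinite.symm b.1) p *
        ∏ i, x i ^ b.1 i := by
    rw [MvPolynomial.eval_eq', Finset.sum_coe_sort (Finset.piAntidiag Finset.univ m)
      (fun b => MvPolynomial.coeff (Finsupp.equivFunOnFinite.symm b) p * ∏ i, x i ^ b i)]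
    refine Finset.sum_of_injOn (fun d => (d : Fin n → ℕ)) (DFunLike.coe_injective.injOn) ?_ ?_ ?_
    · intro d hd
      have hd' := hhom (MvPolynomial.mem_support_iff.1 hd)
      simp only [Finset.mem_coe, Finset.mem_piAntidiag, Finset.mem_univ, implies_true, and_true]
      rw [← hd', Finsupp.weight_apply, Finsupp.sum_fintype _ _ (by simp)]
      simp
    · intro b _ hb
      rw [MvPolynomial.notMem_support_iff.1, zero_mul]
      intro hmem
      exact hb ⟨_, hmem, by simp⟩
    · intro d _
      simp
  have hpos : ∀ b : Mon n m, √(Nat.multinomial Finset.univ b.1 : ℝ) ≠ 0 := fun b =>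
    (Real.sqrt_pos.2 (Nat.cast_pos.2 (Nat.multinomial_pos _ _))).ne'
  simp only [powVec, Matrix.mulVec, dotProduct, powMat, Matrix.of_apply]
  simp only [Matrix.mulVec, dotProduct] at heval
  rw [← heval, hsum, Finset.mul_sum]
  refine Finset.sum_congr rfl fun b _ => ?_
  have := hpos b
  rw [← hp]
  field_simp

theorem powMat_unique {n : ℕ} (m : ℕ) (A : Matrix (Fin n) (Fin n) ℝ)
    (B : Matrix (Mon n m) (Mon n m) ℝ)
    (hB : ∀ x : Fin n → ℝ, powVec m (A.mulVec x) = B.mulVec (powVec m x)) :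
    B = powMat m A := by
  have key : ∀ v : Mon n m → ℝ, (∀ x : Fin n → ℝ, v ⬝ᵥ powVec m x = 0) → v = 0 := by
    intro v hv
    set q : MvPolynomial (Fin n) ℝ := ∑ b : Mon n m,
      MvPolynomial.monomial (Finsupp.equivFunOnFinite.symm b.1)
        (v b * √(Nat.multinomial Finset.univ b.1 : ℝ)) with hq
    have hq0 : q = 0 := by
      refine MvPolynomial.funext fun x => ?_
      rw [map_zero, ← hv x, hq, map_sum, dotProduct]
      refine Finset.sum_congr rfl fun b _ => ?_
      rw [MvPolynomial.eval_monomial, Finsupp.prod_fintype _ _ (by simp), powVec]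
      simp [mul_assoc]
    ext b
    have hb := congrArg (MvPolynomial.coeff (Finsupp.equivFunOnFinite.symm b.1)) hq0
    rw [hq, MvPolynomial.coeff_sum, Finset.sum_eq_single b] at hb
    · rw [MvPolynomial.coeff_monomial, if_pos rfl, MvPolynomial.coeff_zero] at hb
      exact (mul_eq_zero.1 hb).resolve_right
        (Real.sqrt_pos.2 (Nat.cast_pos.2 (Nat.multinomial_pos _ _))).ne'
    · intro c _ hc
      rw [MvPolynomial.coeff_monomial, if_neg]
      exact fun h => hc (Subtype.ext (Finsupp.equivFunOnFinite.symm.injective h))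
    · simp
  ext a b
  have := key (fun c => B a c - powMat m A a c) fun x => by
    have h1 := congrFun ((hB x).symm.trans (powMat_mulVec m A x)) a
    simp only [Matrix.mulVec, dotProduct] at h1 ⊢
    simp only [sub_mul, Finset.sum_sub_distrib, h1, sub_self]
  exact sub_eq_zero.1 (congrFun this b)

/-- A real square matrix is Schur stable if its spectral radius (over `ℂ`) is less than `1`. -/
def SchurStable {ι : Type*} [Fintype ι] [DecidableEq ι] (M : Matrix ι ι ℝ) : Prop :=
  spectralRadius ℂ (M.map (algebraMap ℝ ℂ)) < 1

/-- The data of a stochastic switched system with `N` modes and state space `ℝⁿ` on a measurable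
space `Ω`. The initial mode is a parameter of the system: for every initial mode `s` there are
processes `σ s k`, `t s k`, `J s k` with `σ s 0 = s`. -/
structure SwitchedSystem (N n : ℕ) (Ω : Type*) [MeasurableSpace Ω] where
  A : Fin N → Matrix (Fin n) (Fin n) ℝ
  σ : Fin N → ℕ → Ω → Fin N
  t : Fin N → ℕ → Ω → ℝ
  J : Fin N → ℕ → Ω → Matrix (Fin n) (Fin n) ℝ
  measurable_σ : ∀ s k, Measurable (σ s k)
  measurable_t : ∀ s k, Measurable (t s k)
  measurable_J : ∀ s k, Measurable (J s k)
  σ_zero : ∀ s ω, σ s 0 ω = s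
  t_zero : ∀ s ω, t s 0 ω = 0
  t_mono : ∀ s ω, Monotone fun k => t s k ω

namespace SwitchedSystem

variable {N n : ℕ} {Ω : Type*} [MeasurableSpace Ω]

/-- The dwell times `h_k = t_{k+1} - t_k`. -/
def h (S : SwitchedSystem N n Ω) (s : Fin N) (k : ℕ) (ω : Ω) : ℝ :=
  S.t s (k + 1) ω - S.t s k ω

/-- The `σ`-algebra generated by `σ_k, …, σ_0, t_k, …, t_0, J_{k-1}, …, J_0`. -/
abbrev past (S : SwitchedSystem N n Ω) (s : Fin N) (k : ℕ) : MeasurableSpace Ω :=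
  (⨆ (l : ℕ) (_ : l ≤ k), MeasurableSpace.comap (S.σ s l) inferInstance) ⊔
  (⨆ (l : ℕ) (_ : l ≤ k), MeasurableSpace.comap (S.t s l) inferInstance) ⊔
  (⨆ (l : ℕ) (_ : l < k), MeasurableSpace.comap (S.J s l) inferInstance)

/-- The event `σ_{k+1} = j, h_k ≤ u, J_k ∈ B`. -/
def stepEvent (S : SwitchedSystem N n Ω) (s : Fin N) (k : ℕ) (j : Fin N) (u : ℝ)
    (B : Set (Matrix (Fin n) (Fin n) ℝ)) : Set Ω :=
  {ω | S.σ s (k + 1) ω = j ∧ S.h s k ω ≤ u ∧ S.J s k ω ∈ B}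

/-- Semi-Markovian jump linear systems: the Markovian property and time homogeneity. The common
value of the conditional probabilities in the latter depends neither on `k` nor on the
initial mode. -/
structure IsSemiMarkov (S : SwitchedSystem N n Ω) (P : Measure Ω) : Prop where
  markov : ∀ (s : Fin N) (k : ℕ) (j : Fin N) (u : ℝ), 0 ≤ u →
    ∀ B : Set (Matrix (Fin n) (Fin n) ℝ), MeasurableSet B →
      P⟦S.stepEvent s k j u B | S.past s k⟧ =ᵐ[P]
        P⟦S.stepEvent s k j u B | MeasurableSpace.comap (S.σ s k) inferInstance⟧
  homogeneous : ∀ (i j : Fin N) (u : ℝ), 0 ≤ u →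
    ∀ B : Set (Matrix (Fin n) (Fin n) ℝ), MeasurableSet B →
      ∃ q : ℝ≥0∞, ∀ (s : Fin N) (k : ℕ), P {ω | S.σ s k ω = i} ≠ 0 →
        (cond P {ω | S.σ s k ω = i}) (S.stepEvent s k j u B) = q

/-- Positivity: Metzler modes and almost surely nonnegative reset matrices. -/
structure IsPositive (S : SwitchedSystem N n Ω) (P : Measure Ω) : Prop where
  metzler : ∀ (i : Fin N) (a b : Fin n), a ≠ b → 0 ≤ S.A i a b
  nonneg : ∀ (s : Fin N) (k : ℕ), ∀ᵐ ω ∂P, ∀ a b : Fin n, 0 ≤ S.J s k ω a b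

/-- Positive dwell times, uniformly bounded dwell times, uniformly bounded reset matrices (in the
operator norm induced by the Euclidean norm). -/
structure IsBounded (S : SwitchedSystem N n Ω) (P : Measure Ω) : Prop where
  h_pos : ∀ (s : Fin N) (k : ℕ), ∀ᵐ ω ∂P, 0 < S.h s k ω
  h_le : ∃ T : ℝ, 0 < T ∧ ∀ (s : Fin N) (k : ℕ), ∀ᵐ ω ∂P, S.h s k ω ≤ T
  J_le : ∃ R : ℝ, 0 < R ∧ ∀ (s : Fin N) (k : ℕ), ∀ᵐ ω ∂P,
    ‖Matrix.toEuclideanCLM (𝕜 := ℝ) (S.J s k ω)‖ ≤ R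

/-- `x` is, for the sample point `ω`, the trajectory with initial mode `s` and initial state `x₀`:
`x' = A_{σ_k} x` on `[t_k, t_{k+1})` and `x(t_{k+1}) = J_k x(t_{k+1}⁻)`. -/
structure IsPath (S : SwitchedSystem N n Ω) (s : Fin N) (x₀ : EuclideanSpace ℝ (Fin n)) (ω : Ω)
    (x : ℝ → EuclideanSpace ℝ (Fin n)) : Prop where
  init : x 0 = x₀
  flow : ∀ (k : ℕ), ∀ u ∈ Set.Ico (S.t s k ω) (S.t s (k + 1) ω),
    HasDerivWithinAt x (Matrix.toEuclideanCLM (𝕜 := ℝ) (S.A (S.σ s k ω)) (x u))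
      (Set.Ico (S.t s k ω) (S.t s (k + 1) ω)) u
  reset : ∀ k : ℕ, ∃ y : EuclideanSpace ℝ (Fin n),
    Tendsto x (𝓝[<] (S.t s (k + 1) ω)) (𝓝 y) ∧
      x (S.t s (k + 1) ω) = Matrix.toEuclideanCLM (𝕜 := ℝ) (S.J s k ω) y

/-- The process `x` is the trajectory with initial mode `s` and initial state `x₀`. -/
def IsTrajectory (S : SwitchedSystem N n Ω) (P : Measure Ω) (s : Fin N)
    (x₀ : EuclideanSpace ℝ (Fin n)) (x : ℝ → Ω → EuclideanSpace ℝ (Fin n)) : Prop :=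
  ∀ᵐ ω ∂P, S.IsPath s x₀ ω fun u => x u ω

/-- Exponential `m`-th mean stability. The expectation is the `[0, ∞]`-valued integral, so the
bound includes its finiteness. -/
def ExpMeanStable (S : SwitchedSystem N n Ω) (P : Measure Ω) (m : ℕ) : Prop :=
  ∃ C β : ℝ, 0 < C ∧ 0 < β ∧
    ∀ (s : Fin N) (x₀ : EuclideanSpace ℝ (Fin n)) (x : ℝ → Ω → EuclideanSpace ℝ (Fin n)),
      S.IsTrajectory P s x₀ x → ∀ u : ℝ, 0 ≤ u →
        ∫⁻ ω, ENNReal.ofReal (‖x u ω‖ ^ m) ∂P ≤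
          ENNReal.ofReal (C * Real.exp (-β * u) * ‖x₀‖ ^ m)

/-- The transition probabilities `p_{ij} = P(σ_{k+1} = j ∣ σ_k = i)`. By homogeneity they can be
read off at `k = 0` from the processes with initial mode `i`. -/
def transProb (S : SwitchedSystem N n Ω) (P : Measure Ω) (i j : Fin N) : ℝ :=
  (cond P {ω | S.σ i 0 ω = i}).real {ω | S.σ i 1 ω = j}

/-- The matrix `J_k exp(A_{σ_k} h_k)`. -/
def stepMat (S : SwitchedSystem N n Ω) (s : Fin N) (k : ℕ) (ω : Ω) : Matrix (Fin n) (Fin n) ℝ :=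
  S.J s k ω * NormedSpace.exp (S.h s k ω • S.A (S.σ s k ω))

/-- The block matrix `𝒜_m`, whose `(i, j)` block is
`p_{ji} E[(J_k exp(A_{σ_k} h_k))^[m] ∣ σ_k = j, σ_{k+1} = i]`. By homogeneity the conditional
expectation can be taken at `k = 0` for the processes with initial mode `j`; a block
with `p_{ji} = 0` is zero. -/
def blockMat (S : SwitchedSystem N n Ω) (P : Measure Ω) (m : ℕ) :
    Matrix (Fin N × Mon n m) (Fin N × Mon n m) ℝ :=
  Matrix.of fun a b =>
    S.transProb P b.1 a.1 *
      ∫ ω, powMat m (S.stepMat b.1 0 ω) a.2 b.2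
        ∂(cond P {ω | S.σ b.1 0 ω = b.1 ∧ S.σ b.1 1 ω = a.1})

end SwitchedSystem

end

end SMJLS

/-! ### Monomial vectors and their induced matrices -/

namespace SMJLS

/-! The map `x ↦ x^[m]` makes the `m`-th moments evolve linearly at the switching instants. Write
`x_k` for the state at `t_k`, and let `v_k` collect the expectations of the monomials of `x_k` on
the events `σ_k = i`. Since `x_{k+1}` is the step matrix applied to `x_k`, the Markov property and
homogeneity give `v_{k+1} = 𝒜_m v_k` (`moment_succ`, `moment_eq`). For nonnegative states `‖x_k‖^m`
is comparable to the sum of its monomials, so `v_k` controls the mean; a signed initial state is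
dominated by its entrywise absolute value (`ae_norm_state_le`).

If `𝒜_m` is Schur stable, then `E‖x_k‖^m` decays geometrically. The index of the interval containing
a time `u` is random, but it exists almost surely (`ae_exists_lt_t`) and is at least `⌊u / T⌋`.
Summing the geometric bounds over all such indices gives exponential decay in `u`.

Conversely, exponential stability makes `∫ E‖x(u)‖^m du` finite. Running the flow backwards over a
bounded time bounds this integral below by a multiple of `∑ E[‖x_k‖^m h_k]`. Given the mode, `h_k`
is independent of the past and its mean is bounded below, so `∑ E‖x_k‖^m` converges
(`summable_lintegral_norm_state`). Hence `v_k → 0`; starting from the all-ones vector, nonnegativity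
forces every entry of `𝒜_m ^ k` to tend to zero. -/

instance matrixSecondCountable (n : ℕ) : SecondCountableTopology (Matrix (Fin n) (Fin n) ℝ) :=
  inferInstanceAs (SecondCountableTopology (Fin n → Fin n → ℝ))

theorem powVec_nonneg {n : ℕ} (m : ℕ) {x : Fin n → ℝ} (hx : ∀ i, 0 ≤ x i) (a : Mon n m) :
    0 ≤ powVec m x a :=
  mul_nonneg (Real.sqrt_nonneg _) (Finset.prod_nonneg fun i _ => pow_nonneg (hx i) _)

theorem powVec_one_pos {n : ℕ} (m : ℕ) (a : Mon n m) : 0 < powVec m (fun _ => 1) a := by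
  simp only [powVec, one_pow, Finset.prod_const_one, mul_one]
  exact Real.sqrt_pos.2 (Nat.cast_pos.2 (Nat.multinomial_pos _ _))

theorem continuous_powVec_apply {n : ℕ} (m : ℕ) (a : Mon n m) :
    Continuous fun x : Fin n → ℝ => powVec m x a := by
  unfold powVec
  fun_prop

theorem powVec_le_norm_pow {n : ℕ} (m : ℕ) (x : EuclideanSpace ℝ (Fin n)) (a : Mon n m) :
    powVec m x.ofLp a ≤ ‖x‖ ^ m := by
  have h := norm_powVec m x.ofLp
  rw [WithLp.toLp_ofLp] at h
  rw [← h]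
  exact (le_abs_self _).trans
    (PiLp.norm_apply_le (WithLp.toLp 2 (powVec m x.ofLp) : EuclideanSpace ℝ (Mon n m)) a)

/-- The Euclidean norm of `x^[m]` is at most its `ℓ¹` norm, which for nonnegative `x` is linear in
the monomials. This is how a norm moment becomes a linear functional of the moment vector. -/
theorem norm_pow_le_sum_powVec {n : ℕ} (m : ℕ) (x : EuclideanSpace ℝ (Fin n))
    (hx : ∀ i, 0 ≤ x i) : ‖x‖ ^ m ≤ ∑ a, powVec m x.ofLp a := by
  have h := norm_powVec m x.ofLp
  rw [WithLp.toLp_ofLp] at h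
  have h0 : ∀ a : Mon n m, 0 ≤ powVec m x.ofLp a := powVec_nonneg m hx
  rw [← h, EuclideanSpace.norm_eq]
  refine Real.sqrt_le_iff.2 ⟨Finset.sum_nonneg fun a _ => h0 a, ?_⟩
  simp only [Real.norm_eq_abs, sq_abs]
  exact Finset.sum_sq_le_sq_sum_of_nonneg fun a _ => h0 a

/-- Coefficientwise nonnegative polynomials are closed under products. -/
theorem coeff_mul_nonneg {ι : Type*} {p q : MvPolynomial ι ℝ}
    (hp : ∀ b, 0 ≤ p.coeff b) (hq : ∀ b, 0 ≤ q.coeff b) (b : ι →₀ ℕ) : 0 ≤ (p * q).coeff b := by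
  classical
  rw [MvPolynomial.coeff_mul]
  exact Finset.sum_nonneg fun x _ => mul_nonneg (hp _) (hq _)

theorem coeff_one_nonneg {ι : Type*} (b : ι →₀ ℕ) :
    0 ≤ (1 : MvPolynomial ι ℝ).coeff b := by
  classical
  rw [MvPolynomial.coeff_one]
  split_ifs <;> simp

/-- Up to positive factors the entries are coefficients of products of linear forms with nonnegative
coefficients. -/
theorem powMat_nonneg {n : ℕ} (m : ℕ) {A : Matrix (Fin n) (Fin n) ℝ} (hA : ∀ i j, 0 ≤ A i j)
    (a b : Mon n m) : 0 ≤ powMat m A a b := by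
  classical
  refine mul_nonneg (by positivity) ?_
  have hlin : ∀ i b, 0 ≤ (∑ j, MvPolynomial.C (A i j) * MvPolynomial.X j :
      MvPolynomial (Fin n) ℝ).coeff b := fun i b => by
    rw [MvPolynomial.coeff_sum]
    refine Finset.sum_nonneg fun j _ => ?_
    rw [MvPolynomial.coeff_C_mul, MvPolynomial.coeff_X]
    split_ifs <;> simp [hA i j]
  refine Finset.prod_induction _ (fun p : MvPolynomial (Fin n) ℝ => ∀ b, 0 ≤ p.coeff b)
    (fun p q hp hq => coeff_mul_nonneg hp hq) coeff_one_nonneg (fun i _ => ?_) _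
  induction a.1 i with
  | zero => simpa using coeff_one_nonneg
  | succ k ih => rw [pow_succ]; exact coeff_mul_nonneg ih (hlin i)

theorem continuous_coeff_mul {X ι : Type*} [TopologicalSpace X] {p q : X → MvPolynomial ι ℝ}
    (hp : ∀ b, Continuous fun x => (p x).coeff b) (hq : ∀ b, Continuous fun x => (q x).coeff b)
    (b : ι →₀ ℕ) : Continuous fun x => (p x * q x).coeff b := by
  classical
  simp only [MvPolynomial.coeff_mul]
  exact continuous_finsetSum _ fun y _ => (hp _).mul (hq _)

theorem continuous_powMat_apply {n : ℕ} (m : ℕ) (a b : Mon n m) :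
    Continuous fun A : Matrix (Fin n) (Fin n) ℝ => powMat m A a b := by
  classical
  refine continuous_const.mul ?_
  have hlin : ∀ i b, Continuous fun A : Matrix (Fin n) (Fin n) ℝ =>
      (∑ j, MvPolynomial.C (A i j) * MvPolynomial.X j :
      MvPolynomial (Fin n) ℝ).coeff b := fun i b => by
    simp only [MvPolynomial.coeff_sum, MvPolynomial.coeff_C_mul]
    fun_prop
  have := Finset.prod_induction
    (fun i => fun A : Matrix (Fin n) (Fin n) ℝ =>
      (∑ j, MvPolynomial.C (A i j) * MvPolynomial.X j : MvPolynomial (Fin n) ℝ) ^ a.1 i)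
    (fun p => ∀ b, Continuous fun A => (p A).coeff b)
    (fun p q hp hq => continuous_coeff_mul hp hq) (fun b => continuous_const) (s := Finset.univ)
    (fun i _ => ?_) (Finsupp.equivFunOnFinite.symm b.1)
  · simpa only [Finset.prod_apply] using this
  · induction a.1 i with
    | zero => simpa using fun b => continuous_const
    | succ k ih => simp only [pow_succ]; exact continuous_coeff_mul ih (hlin i)

/-- Testing on the all-ones vector, all of whose monomials are positive, bounds each entry by a full
row sum of nonnegative terms. -/
theorem powMat_le {n : ℕ} (m : ℕ) {A : Matrix (Fin n) (Fin n) ℝ} (hA : ∀ i j, 0 ≤ A i j)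
    (a b : Mon n m) : powMat m A a b ≤
      (‖Matrix.toEuclideanCLM (𝕜 := ℝ) A‖ * ‖(WithLp.toLp 2 fun _ => 1 : EuclideanSpace ℝ (Fin n))‖)
        ^ m / powVec m (fun _ => 1) b := by
  rw [le_div_iff₀ (powVec_one_pos m b)]
  set e : EuclideanSpace ℝ (Fin n) := WithLp.toLp 2 fun _ => 1
  calc powMat m A a b * powVec m (fun _ => 1) b
      ≤ (powMat m A).mulVec (powVec m (fun _ => 1)) a :=
        Finset.single_le_sum (f := fun b => powMat m A a b * powVec m (fun _ => 1) b)
          (fun c _ => mul_nonneg (powMat_nonneg m hA a c) (powVec_one_pos m c).le)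
          (Finset.mem_univ b)
    _ = powVec m (Matrix.toEuclideanCLM (𝕜 := ℝ) A e).ofLp a := by
        rw [← powMat_mulVec, Matrix.ofLp_toEuclideanCLM]
    _ ≤ ‖Matrix.toEuclideanCLM (𝕜 := ℝ) A e‖ ^ m := powVec_le_norm_pow m _ a
    _ ≤ _ := pow_le_pow_left₀ (norm_nonneg _) (ContinuousLinearMap.le_opNorm _ _) m

/-! ### Matrix exponentials and linear flows -/

section Exp

open scoped Matrix.Norms.L2Operator

theorem continuous_exp_matrix (n : ℕ) :
    Continuous (NormedSpace.exp : Matrix (Fin n) (Fin n) ℝ → Matrix (Fin n) (Fin n) ℝ) := by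
  let _ : NormedAlgebra ℚ (Matrix (Fin n) (Fin n) ℝ) := NormedAlgebra.restrictScalars ℚ ℝ _
  exact NormedSpace.exp_continuous

theorem exp_nonneg_of_nonneg {n : ℕ} {A : Matrix (Fin n) (Fin n) ℝ} (hA : ∀ i j, 0 ≤ A i j)
    (i j : Fin n) : 0 ≤ NormedSpace.exp A i j := by
  have h := NormedSpace.exp_series_hasSum_exp' (𝕂 := ℝ) A
  have hpow : ∀ k i j, 0 ≤ (A ^ k) i j := fun k => by
    induction k with
    | zero =>
      intro i j
      rw [pow_zero, Matrix.one_apply]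
      split_ifs <;> simp
    | succ k ih =>
      intro i j
      rw [pow_succ, Matrix.mul_apply]
      exact Finset.sum_nonneg fun l _ => mul_nonneg (ih i l) (hA l j)
  have h1 : HasSum (fun k : ℕ => ((k.factorial : ℝ)⁻¹ • A ^ k) i j) (NormedSpace.exp A i j) :=
    h.map (Matrix.entryAddMonoidHom ℝ i j) (continuous_id.matrix_elem i j)
  exact h1.nonneg fun k => mul_nonneg (by positivity) (hpow k i j)

theorem exp_smul_nonneg_of_metzler {n : ℕ} {A : Matrix (Fin n) (Fin n) ℝ}
    (hA : ∀ i j, i ≠ j → 0 ≤ A i j) {τ : ℝ} (hτ : 0 ≤ τ) (i j : Fin n) :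
    0 ≤ NormedSpace.exp (τ • A) i j := by
  -- The shift `c` makes the diagonal of `τ • A` nonnegative; being scalar it commutes with
  -- everything and costs only the positive factor `exp (-c)`.
  set c : ℝ := τ * ∑ l, |A l l| with hc
  have hsplit : τ • A = (τ • A + Matrix.diagonal fun _ => c) + Matrix.diagonal fun _ => -c := by
    rw [add_assoc, Matrix.diagonal_add]
    simp
  have hcomm : Commute (τ • A + Matrix.diagonal fun _ => c) (Matrix.diagonal fun _ => -c) := by
    have : (Matrix.diagonal fun _ => -c : Matrix (Fin n) (Fin n) ℝ) = Matrix.scalar (Fin n) (-c) :=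
      rfl
    rw [this]
    exact (Matrix.scalar_commute _ (fun _ => Commute.all _ _) _).symm
  rw [hsplit, Matrix.exp_add_of_commute _ _ hcomm, Matrix.exp_diagonal, Matrix.mul_diagonal]
  refine mul_nonneg (exp_nonneg_of_nonneg (fun k l => ?_) i j) ?_
  · rw [Matrix.add_apply, Matrix.smul_apply, smul_eq_mul]
    by_cases hkl : k = l
    · subst hkl
      rw [Matrix.diagonal_apply_eq, hc, ← mul_add]
      refine mul_nonneg hτ ?_
      have h1 : |A k k| ≤ ∑ l, |A l l| := Finset.single_le_sum (f := fun l => |A l l|)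
        (fun l _ => abs_nonneg (A l l)) (Finset.mem_univ k)
      have h2 := neg_abs_le (A k k)
      linarith
    · rw [Matrix.diagonal_apply_ne _ hkl, add_zero]
      exact mul_nonneg hτ (hA k l hkl)
  · rw [Pi.coe_exp, ← Real.exp_eq_exp_ℝ]
    exact (Real.exp_pos _).le

/-- The flow of `x' = A x` in Euclidean space. -/
noncomputable def matFlow {n : ℕ} (A : Matrix (Fin n) (Fin n) ℝ) (τ : ℝ) :
    EuclideanSpace ℝ (Fin n) →L[ℝ] EuclideanSpace ℝ (Fin n) :=
  Matrix.toEuclideanCLM (𝕜 := ℝ) (NormedSpace.exp (τ • A))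

/-- `Matrix.toEuclideanCLM` is an isometric algebra homomorphism, so it commutes with the
exponential series. -/
theorem matFlow_eq_exp {n : ℕ} (A : Matrix (Fin n) (Fin n) ℝ) (τ : ℝ) :
    matFlow A τ = NormedSpace.exp (τ • Matrix.toEuclideanCLM (𝕜 := ℝ) A) := by
  let _ : NormedAlgebra ℚ (Matrix (Fin n) (Fin n) ℝ) := NormedAlgebra.restrictScalars ℚ ℝ _
  have hc : Continuous (Matrix.toEuclideanCLM (n := Fin n) (𝕜 := ℝ)) :=
    (AddMonoidHomClass.isometry_of_norm (Matrix.toEuclideanCLM (n := Fin n) (𝕜 := ℝ))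
      fun A => Matrix.l2_opNorm_toEuclideanCLM A).continuous
  rw [matFlow, NormedSpace.map_exp _ hc, map_smul]

theorem hasDerivAt_matFlow {n : ℕ} (A : Matrix (Fin n) (Fin n) ℝ) (x : EuclideanSpace ℝ (Fin n))
    (τ : ℝ) :
    HasDerivAt (fun u => matFlow A u x) (Matrix.toEuclideanCLM (𝕜 := ℝ) A (matFlow A τ x)) τ := by
  simp only [matFlow_eq_exp]
  exact (hasDerivAt_exp_smul_const' (𝕂 := ℝ) (Matrix.toEuclideanCLM (𝕜 := ℝ) A) τ).clm_apply
    (hasDerivAt_const τ x) |>.congr_deriv (by simp)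

theorem continuous_matFlow {n : ℕ} (A : Matrix (Fin n) (Fin n) ℝ) : Continuous (matFlow A) := by
  rw [funext (matFlow_eq_exp A)]
  exact continuous_iff_continuousAt.2 fun τ =>
    (hasDerivAt_exp_smul_const' (𝕂 := ℝ) (Matrix.toEuclideanCLM (𝕜 := ℝ) A) τ).continuousAt

@[simp] theorem matFlow_zero {n : ℕ} (A : Matrix (Fin n) (Fin n) ℝ) : matFlow A 0 = 1 := by
  rw [matFlow, zero_smul, NormedSpace.exp_zero, map_one]

theorem matFlow_neg_apply_matFlow {n : ℕ} (A : Matrix (Fin n) (Fin n) ℝ) (τ : ℝ)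
    (x : EuclideanSpace ℝ (Fin n)) : matFlow A (-τ) (matFlow A τ x) = x := by
  have h : NormedSpace.exp (-τ • A) * NormedSpace.exp (τ • A) = 1 := by
    rw [← Matrix.exp_add_of_commute _ _ ((Commute.refl A).smul_left _ |>.smul_right _), ← add_smul,
      neg_add_cancel, zero_smul, NormedSpace.exp_zero]
  rw [matFlow, matFlow, ← mul_apply_eq_comp, ← map_mul, h, map_one]
  rfl

/-- A uniform bound of finitely many flows on a bounded time interval. -/
theorem exists_norm_matFlow_le {ι : Type*} [Finite ι] {n : ℕ} (A : ι → Matrix (Fin n) (Fin n) ℝ)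
    (T : ℝ) : ∃ K : ℝ, 1 ≤ K ∧ ∀ i, ∀ τ ∈ Set.Icc (-T) T, ‖matFlow (A i) τ‖ ≤ K := by
  have h : ∀ i, ∃ K : ℝ, ∀ τ ∈ Set.Icc (-T) T, ‖matFlow (A i) τ‖ ≤ K := fun i =>
    isCompact_Icc.exists_bound_of_continuousOn (continuous_matFlow (A i)).continuousOn
  choose K hK using h
  obtain ⟨M, hM⟩ := (Set.finite_range K).bddAbove
  exact ⟨max 1 M, le_max_left _ _, fun i τ hτ =>
    (hK i τ hτ).trans ((hM ⟨i, rfl⟩).trans (le_max_right _ _))⟩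

end Exp

end SMJLS

/-! ### Trajectories and their values at the switching instants -/

namespace SMJLS

/-- Uniqueness for `x' = A x` on a half-open interval. -/
theorem eq_flow_of_hasDerivWithinAt {n : ℕ} {A : Matrix (Fin n) (Fin n) ℝ}
    {x : ℝ → EuclideanSpace ℝ (Fin n)} {a b : ℝ}
    (hx : ∀ u ∈ Set.Ico a b,
      HasDerivWithinAt x (Matrix.toEuclideanCLM (𝕜 := ℝ) A (x u)) (Set.Ico a b) u)
    {u : ℝ} (hu : u ∈ Set.Ico a b) : x u = matFlow A (u - a) (x a) := by
  have hsub : Set.Icc a u ⊆ Set.Ico a b := fun v hv => ⟨hv.1, hv.2.trans_lt hu.2⟩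
  have hderiv : ∀ v, HasDerivAt (fun w => matFlow A (w - a) (x a))
      (Matrix.toEuclideanCLM (𝕜 := ℝ) A (matFlow A (v - a) (x a))) v := fun v =>
    (hasDerivAt_matFlow A (x a) (v - a)).comp_sub_const v a
  refine ODE_solution_unique_of_mem_Icc_right (a := a) (b := u) (s := fun _ => Set.univ)
    (v := fun _ => Matrix.toEuclideanCLM (𝕜 := ℝ) A)
    (fun _ _ => (Matrix.toEuclideanCLM (𝕜 := ℝ) A).lipschitz.lipschitzOnWith)
    (fun v hv => ((hx v (hsub hv)).continuousWithinAt).mono hsub)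
    (fun v hv => ?_) (fun _ _ => Set.mem_univ _)
    (fun v _ => (hderiv v).continuousAt.continuousWithinAt)
    (fun v _ => (hderiv v).hasDerivWithinAt) (fun _ _ => Set.mem_univ _) (by simp) ⟨hu.1, le_rfl⟩
  have hv' : v ∈ Set.Ico a b := hsub ⟨hv.1, hv.2.le⟩
  -- Uniqueness asks for right derivatives, and `Set.Ico a b` contains a right neighbourhood of `v`.
  refine (hx v hv').mono_of_mem_nhdsWithin ?_
  exact mem_of_superset (Ico_mem_nhdsGE hv'.2) (Set.Ico_subset_Ico_left hv'.1)

namespace SwitchedSystem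

variable {N n : ℕ} {Ω : Type*} [MeasurableSpace Ω]

/-- The state `x(t_k)` at the `k`-th switching instant. -/
noncomputable def state (S : SwitchedSystem N n Ω) (s : Fin N) (x₀ : EuclideanSpace ℝ (Fin n)) :
    ℕ → Ω → EuclideanSpace ℝ (Fin n)
  | 0, _ => x₀
  | k + 1, ω => Matrix.toEuclideanCLM (𝕜 := ℝ) (S.stepMat s k ω) (state S s x₀ k ω)

theorem toEuclideanCLM_stepMat (S : SwitchedSystem N n Ω) (s : Fin N) (k : ℕ) (ω : Ω) :
    Matrix.toEuclideanCLM (𝕜 := ℝ) (S.stepMat s k ω) =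
      Matrix.toEuclideanCLM (𝕜 := ℝ) (S.J s k ω) * matFlow (S.A (S.σ s k ω)) (S.h s k ω) := by
  rw [stepMat, map_mul, matFlow]

theorem tendsto_matFlow_sub {A : Matrix (Fin n) (Fin n) ℝ} (a b : ℝ)
    (y : EuclideanSpace ℝ (Fin n)) :
    Tendsto (fun u => matFlow A (u - a) y) (𝓝 b) (𝓝 (matFlow A (b - a) y)) :=
  ((((continuous_matFlow A).comp (continuous_sub_right a)).clm_apply continuous_const).tendsto b)

/-- The flow determines the left limit at `t_{k+1}`. Since `h_k > 0`, the interval is a left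
neighbourhood of that instant, so uniqueness of limits identifies the vector being reset. -/
theorem IsPath.apply_t {S : SwitchedSystem N n Ω} {s : Fin N} {x₀ : EuclideanSpace ℝ (Fin n)}
    {ω : Ω} {x : ℝ → EuclideanSpace ℝ (Fin n)} (hx : S.IsPath s x₀ ω x)
    (ht : ∀ k, 0 < S.h s k ω) (k : ℕ) : x (S.t s k ω) = S.state s x₀ k ω := by
  induction k with
  | zero => rw [S.t_zero, hx.init, state]
  | succ k ih =>
    have hlt : S.t s k ω < S.t s (k + 1) ω := sub_pos.1 (ht k)
    obtain ⟨y, hy, hxy⟩ := hx.reset k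
    have hlim : Tendsto x (𝓝[<] (S.t s (k + 1) ω))
        (𝓝 (matFlow (S.A (S.σ s k ω)) (S.h s k ω) (S.state s x₀ k ω))) := by
      refine ((tendsto_matFlow_sub (A := S.A (S.σ s k ω)) (S.t s k ω) (S.t s (k + 1) ω)
        (S.state s x₀ k ω)).mono_left nhdsWithin_le_nhds).congr' ?_
      filter_upwards [Ico_mem_nhdsLT hlt] with u hu
      rw [← ih, eq_flow_of_hasDerivWithinAt (hx.flow k) hu]
    rw [hxy, tendsto_nhds_unique hy hlim, state, toEuclideanCLM_stepMat, mul_apply_eq_comp]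

theorem IsPath.eq_flow {S : SwitchedSystem N n Ω} {s : Fin N} {x₀ : EuclideanSpace ℝ (Fin n)}
    {ω : Ω} {x : ℝ → EuclideanSpace ℝ (Fin n)} (hx : S.IsPath s x₀ ω x)
    (ht : ∀ k, 0 < S.h s k ω) {k : ℕ} {u : ℝ}
    (hu : u ∈ Set.Ico (S.t s k ω) (S.t s (k + 1) ω)) :
    x u = matFlow (S.A (S.σ s k ω)) (u - S.t s k ω) (S.state s x₀ k ω) := by
  rw [← hx.apply_t ht, eq_flow_of_hasDerivWithinAt (hx.flow k) hu]

open Classical in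
/-- The trajectory with initial mode `s` and initial state `x₀`, continued by `0` beyond an
accumulation point of the switching instants. -/
noncomputable def trajectory (S : SwitchedSystem N n Ω) (s : Fin N)
    (x₀ : EuclideanSpace ℝ (Fin n)) (u : ℝ) (ω : Ω) : EuclideanSpace ℝ (Fin n) :=
  if h : ∃ k, u ∈ Set.Ico (S.t s k ω) (S.t s (k + 1) ω) then
    matFlow (S.A (S.σ s h.choose ω)) (u - S.t s h.choose ω) (S.state s x₀ h.choose ω)
  else 0

theorem trajectory_eq (S : SwitchedSystem N n Ω) (s : Fin N) (x₀ : EuclideanSpace ℝ (Fin n))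
    {u : ℝ} {ω : Ω} {k : ℕ} (hu : u ∈ Set.Ico (S.t s k ω) (S.t s (k + 1) ω)) :
    S.trajectory s x₀ u ω =
      matFlow (S.A (S.σ s k ω)) (u - S.t s k ω) (S.state s x₀ k ω) := by
  have h : ∃ k, u ∈ Set.Ico (S.t s k ω) (S.t s (k + 1) ω) := ⟨k, hu⟩
  -- Monotone switching instants make the half-open intervals disjoint.
  have hk : h.choose = k := by
    have h1 := h.choose_spec
    refine le_antisymm (Nat.lt_succ_iff.1 ((S.t_mono s ω).reflect_lt ?_))
      (Nat.lt_succ_iff.1 ((S.t_mono s ω).reflect_lt ?_))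
    · exact h1.1.trans_lt hu.2
    · exact hu.1.trans_lt h1.2
  rw [trajectory, dif_pos h, hk]

theorem isPath_trajectory (S : SwitchedSystem N n Ω) (s : Fin N) (x₀ : EuclideanSpace ℝ (Fin n))
    {ω : Ω} (ht : ∀ k, 0 < S.h s k ω) :
    S.IsPath s x₀ ω fun u => S.trajectory s x₀ u ω := by
  have hlt : ∀ k, S.t s k ω < S.t s (k + 1) ω := fun k => sub_pos.1 (ht k)
  have happ : ∀ k, S.trajectory s x₀ (S.t s k ω) ω = S.state s x₀ k ω := fun k => by
    rw [S.trajectory_eq s x₀ (Set.left_mem_Ico.2 (hlt k)), sub_self, matFlow_zero]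
    rfl
  refine ⟨?_, fun k u hu => ?_, fun k => ?_⟩
  · have := happ 0
    rwa [S.t_zero] at this
  · have heq : Set.EqOn (fun u => S.trajectory s x₀ u ω)
        (fun u => matFlow (S.A (S.σ s k ω)) (u - S.t s k ω) (S.state s x₀ k ω))
        (Set.Ico (S.t s k ω) (S.t s (k + 1) ω)) := fun v hv => S.trajectory_eq s x₀ hv
    refine HasDerivWithinAt.congr_of_mem ?_ heq hu
    rw [S.trajectory_eq s x₀ hu]
    exact ((hasDerivAt_matFlow _ _ _).comp_sub_const u (S.t s k ω)).hasDerivWithinAt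
  · refine ⟨matFlow (S.A (S.σ s k ω)) (S.h s k ω) (S.state s x₀ k ω), ?_, ?_⟩
    · refine ((tendsto_matFlow_sub (A := S.A (S.σ s k ω)) (S.t s k ω) (S.t s (k + 1) ω)
        (S.state s x₀ k ω)).mono_left nhdsWithin_le_nhds).congr' ?_
      filter_upwards [Ico_mem_nhdsLT (hlt k)] with u hu
      rw [S.trajectory_eq s x₀ hu]
    · rw [happ, state, toEuclideanCLM_stepMat, mul_apply_eq_comp]

theorem ae_h_pos {S : SwitchedSystem N n Ω} {P : Measure Ω} (hbd : S.IsBounded P) (s : Fin N) :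
    ∀ᵐ ω ∂P, ∀ k, 0 < S.h s k ω :=
  ae_all_iff.2 (hbd.h_pos s)

/-- Stability quantifies over trajectories; this supplies the one to which the necessity direction
applies it. -/
theorem isTrajectory_trajectory {S : SwitchedSystem N n Ω} {P : Measure Ω} (hbd : S.IsBounded P)
    (s : Fin N) (x₀ : EuclideanSpace ℝ (Fin n)) :
    S.IsTrajectory P s x₀ (S.trajectory s x₀) :=
  (ae_h_pos hbd s).mono fun _ hω => S.isPath_trajectory s x₀ hω

end SwitchedSystem

end SMJLS

/-! ### Measurability with respect to the past -/

namespace SMJLS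

theorem measurable_toEuclideanCLM_apply {n : ℕ} {X : Type*} {mX : MeasurableSpace X}
    {M : X → Matrix (Fin n) (Fin n) ℝ} {y : X → EuclideanSpace ℝ (Fin n)} (hM : Measurable M)
    (hy : Measurable y) : Measurable fun x => Matrix.toEuclideanCLM (𝕜 := ℝ) (M x) (y x) := by
  have h : Continuous fun p : Matrix (Fin n) (Fin n) ℝ × EuclideanSpace ℝ (Fin n) =>
      (WithLp.toLp 2 (p.1.mulVec p.2.ofLp) : EuclideanSpace ℝ (Fin n)) :=
    (PiLp.continuous_toLp 2 _).comp (continuous_fst.matrix_mulVec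
      ((PiLp.continuous_ofLp 2 _).comp continuous_snd))
  exact h.measurable.comp (hM.prodMk hy)

namespace SwitchedSystem

variable {N n : ℕ} {Ω : Type*} [MeasurableSpace Ω]

theorem measurable_h (S : SwitchedSystem N n Ω) (s : Fin N) (k : ℕ) : Measurable (S.h s k) :=
  (S.measurable_t s (k + 1)).sub (S.measurable_t s k)

theorem h_nonneg (S : SwitchedSystem N n Ω) (s : Fin N) (k : ℕ) (ω : Ω) : 0 ≤ S.h s k ω :=
  sub_nonneg.2 (S.t_mono s ω (Nat.le_succ k))

theorem past_le (S : SwitchedSystem N n Ω) (s : Fin N) (k : ℕ) :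
    S.past s k ≤ ‹MeasurableSpace Ω› :=
  sup_le (sup_le (iSup₂_le fun l _ => (S.measurable_σ s l).comap_le)
    (iSup₂_le fun l _ => (S.measurable_t s l).comap_le))
    (iSup₂_le fun l _ => (S.measurable_J s l).comap_le)

theorem measurable_past_σ (S : SwitchedSystem N n Ω) (s : Fin N) {k l : ℕ} (hl : l ≤ k) :
    Measurable[S.past s k] (S.σ s l) :=
  measurable_iff_comap_le.2 (le_sup_of_le_left (le_sup_of_le_left
    (le_iSup₂ (f := fun l (_ : l ≤ k) => MeasurableSpace.comap (S.σ s l) inferInstance) l hl)))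

theorem measurable_past_t (S : SwitchedSystem N n Ω) (s : Fin N) {k l : ℕ} (hl : l ≤ k) :
    Measurable[S.past s k] (S.t s l) :=
  measurable_iff_comap_le.2 (le_sup_of_le_left (le_sup_of_le_right
    (le_iSup₂ (f := fun l (_ : l ≤ k) => MeasurableSpace.comap (S.t s l) inferInstance) l hl)))

theorem measurable_past_J (S : SwitchedSystem N n Ω) (s : Fin N) {k l : ℕ} (hl : l < k) :
    Measurable[S.past s k] (S.J s l) :=
  measurable_iff_comap_le.2 (le_sup_of_le_right
    (le_iSup₂ (f := fun l (_ : l < k) => MeasurableSpace.comap (S.J s l) inferInstance) l hl))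

theorem past_mono (S : SwitchedSystem N n Ω) (s : Fin N) : Monotone (S.past s) := fun _ _ hkl =>
  sup_le (sup_le
    (iSup₂_le fun _ hi => measurable_iff_comap_le.1 (S.measurable_past_σ s (hi.trans hkl)))
    (iSup₂_le fun _ hi => measurable_iff_comap_le.1 (S.measurable_past_t s (hi.trans hkl))))
    (iSup₂_le fun _ hi => measurable_iff_comap_le.1 (S.measurable_past_J s (hi.trans_le hkl)))

/-- The step matrix as a function of the mode, the dwell time and the reset matrix. -/
noncomputable def stepFun (S : SwitchedSystem N n Ω) (i : Fin N)
    (z : ℝ × Matrix (Fin n) (Fin n) ℝ) : Matrix (Fin n) (Fin n) ℝ :=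
  z.2 * NormedSpace.exp (z.1 • S.A i)

theorem measurable_stepFun (S : SwitchedSystem N n Ω) (i : Fin N) : Measurable (S.stepFun i) :=
  (continuous_snd.matrix_mul
    ((continuous_exp_matrix n).comp (continuous_fst.smul continuous_const))).measurable

theorem measurable_past_stepMat (S : SwitchedSystem N n Ω) (s : Fin N) (k : ℕ) :
    Measurable[S.past s (k + 1)] (S.stepMat s k) := by
  have h1 : Measurable fun p : Fin N × (ℝ × Matrix (Fin n) (Fin n) ℝ) => S.stepFun p.1 p.2 :=
    measurable_from_prod_countable_right fun i => S.measurable_stepFun i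
  exact h1.comp ((S.measurable_past_σ s k.le_succ).prodMk
    (((S.measurable_past_t s le_rfl).sub (S.measurable_past_t s k.le_succ)).prodMk
      (S.measurable_past_J s k.lt_succ_self)))

/-- The state at `t_k` involves only the modes, dwell times and resets of indices below `k`, so it
is known before `h_k` and `J_k`. This allows the Markov property to be applied to it. -/
theorem measurable_past_state (S : SwitchedSystem N n Ω) (s : Fin N)
    (x₀ : EuclideanSpace ℝ (Fin n)) (k : ℕ) : Measurable[S.past s k] (S.state s x₀ k) := by
  induction k with
  | zero => exact measurable_const
  | succ k ih =>
    have h3 : Measurable[S.past s (k + 1)] (S.state s x₀ k) :=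
      ih.mono (S.past_mono s k.le_succ) le_rfl
    have h4 : S.state s x₀ (k + 1) = fun ω =>
        Matrix.toEuclideanCLM (𝕜 := ℝ) (S.stepMat s k ω) (S.state s x₀ k ω) := rfl
    rw [h4]
    exact @measurable_toEuclideanCLM_apply n Ω (S.past s (k + 1)) _ _
      (S.measurable_past_stepMat s k) h3

theorem measurable_state (S : SwitchedSystem N n Ω) (s : Fin N) (x₀ : EuclideanSpace ℝ (Fin n))
    (k : ℕ) : Measurable (S.state s x₀ k) :=
  (S.measurable_past_state s x₀ k).mono (S.past_le s k) le_rfl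

theorem measurableSet_σ (S : SwitchedSystem N n Ω) (s : Fin N) (k : ℕ) (i : Fin N) :
    MeasurableSet {ω | S.σ s k ω = i} :=
  S.measurable_σ s k (measurableSet_singleton i)

theorem measurableSet_past_σ (S : SwitchedSystem N n Ω) (s : Fin N) (k : ℕ) (i : Fin N) :
    MeasurableSet[S.past s k] {ω | S.σ s k ω = i} :=
  S.measurable_past_σ s le_rfl (measurableSet_singleton i)

theorem measurableSet_stepEvent (S : SwitchedSystem N n Ω) (s : Fin N) (k : ℕ) (j : Fin N)
    (u : ℝ) {B : Set (Matrix (Fin n) (Fin n) ℝ)} (hB : MeasurableSet B) :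
    MeasurableSet (S.stepEvent s k j u B) :=
  (S.measurableSet_σ s (k + 1) j).inter
    ((S.measurable_h s k measurableSet_Iic).inter (S.measurable_J s k hB))

/-- The joint law of dwell time and reset matrix on the event of a transition from `i` to `j`. -/
noncomputable def stepLaw (S : SwitchedSystem N n Ω) (P : Measure Ω) (i j : Fin N) :
    Measure (ℝ × Matrix (Fin n) (Fin n) ℝ) :=
  (P.restrict {ω | S.σ i 1 ω = j}).map fun ω => (S.h i 0 ω, S.J i 0 ω)

theorem measurable_h_J (S : SwitchedSystem N n Ω) (s : Fin N) (k : ℕ) :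
    Measurable fun ω => (S.h s k ω, S.J s k ω) :=
  (S.measurable_h s k).prodMk (S.measurable_J s k)

instance (S : SwitchedSystem N n Ω) (P : Measure Ω) [IsFiniteMeasure P] (i j : Fin N) :
    IsFiniteMeasure (S.stepLaw P i j) := by
  unfold stepLaw; infer_instance

theorem lintegral_stepLaw (S : SwitchedSystem N n Ω) (P : Measure Ω) (i j : Fin N)
    {g : ℝ × Matrix (Fin n) (Fin n) ℝ → ℝ≥0∞} (hg : Measurable g) :
    ∫⁻ z, g z ∂(S.stepLaw P i j) =
      ∫⁻ ω in {ω | S.σ i 1 ω = j}, g (S.h i 0 ω, S.J i 0 ω) ∂P :=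
  lintegral_map hg (S.measurable_h_J i 0)

/-- Integrals are sums over the values of a mode. -/
theorem sum_setLIntegral_σ (S : SwitchedSystem N n Ω) (P : Measure Ω) (s : Fin N) (k : ℕ) (E : Set Ω)
    (f : Ω → ℝ≥0∞) :
    ∑ j, ∫⁻ ω in E ∩ {ω | S.σ s k ω = j}, f ω ∂P = ∫⁻ ω in E, f ω ∂P := by
  have hE : (⋃ j, {ω | S.σ s k ω = j}) = Set.univ :=
    Set.eq_univ_of_forall fun ω => Set.mem_iUnion.2 ⟨_, rfl⟩
  have h := lintegral_iUnion (μ := P.restrict E) (s := fun j => {ω | S.σ s k ω = j})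
    (fun j => S.measurableSet_σ s k j)
    (fun a b hab => Set.disjoint_left.2 fun ω ha hb => hab (ha.symm.trans hb)) f
  rw [hE, Measure.restrict_univ, tsum_fintype] at h
  rw [h]
  refine Finset.sum_congr rfl fun j _ => ?_
  rw [Measure.restrict_restrict (S.measurableSet_σ s k j), Set.inter_comm]

/-! ### The Markov property in integrated form -/

variable {P : Measure Ω} [IsProbabilityMeasure P] {S : SwitchedSystem N n Ω}

/-- The conditional probability given `σ_k` is a constant `c` on `σ_k = i`. Integrating the Markov
identity over past events inside that set extracts `c`, and homogeneity compares `(s, k)` with `(i,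
0)`, where the mode is surely `i`, to evaluate it. -/
theorem measure_inter_stepEvent (hS : S.IsSemiMarkov P) (s : Fin N) (k : ℕ) (i j : Fin N)
    {u : ℝ} (hu : 0 ≤ u) {B : Set (Matrix (Fin n) (Fin n) ℝ)} (hB : MeasurableSet B)
    {F : Set Ω} (hF : MeasurableSet[S.past s k] F) :
    P (F ∩ {ω | S.σ s k ω = i} ∩ S.stepEvent s k j u B) =
      P (F ∩ {ω | S.σ s k ω = i}) * P (S.stepEvent i 0 j u B) := by
  set E := S.stepEvent s k j u B with hE
  set G := {ω | S.σ s k ω = i} with hG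
  have hEm : MeasurableSet E := S.measurableSet_stepEvent s k j u hB
  have hGm : MeasurableSet G := S.measurableSet_σ s k i
  have hGp : MeasurableSet[S.past s k] G := S.measurableSet_past_σ s k i
  have hFm : MeasurableSet F := S.past_le s k F hF
  have hle : MeasurableSpace.comap (S.σ s k) inferInstance ≤ ‹MeasurableSpace Ω› :=
    (S.measurable_σ s k).comap_le
  have hint : Integrable (E.indicator fun _ => (1 : ℝ)) P :=
    (integrable_const 1).indicator hEm
  by_cases h0 : P G = 0
  · rw [measure_mono_null (fun ω hω => hω.1.2) h0,
      measure_mono_null Set.inter_subset_right h0, zero_mul]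
  obtain ⟨c, hc⟩ : ∃ c : ℝ, ∀ ω ∈ G,
      (P⟦E | MeasurableSpace.comap (S.σ s k) inferInstance⟧) ω = c := by
    have hm : Measurable[MeasurableSpace.comap (S.σ s k) inferInstance]
        (P⟦E | MeasurableSpace.comap (S.σ s k) inferInstance⟧) :=
      stronglyMeasurable_condExp.measurable
    have hft := hm.factorsThrough
    by_cases hne : G.Nonempty
    · obtain ⟨ω₀, hω₀⟩ := hne
      exact ⟨_, fun ω hω => hft (hω.trans hω₀.symm)⟩
    · exact ⟨0, fun ω hω => (hne ⟨ω, hω⟩).elim⟩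
  have key : ∀ F, MeasurableSet[S.past s k] F → P.real (F ∩ G ∩ E) = P.real (F ∩ G) * c := by
    intro F hF
    have hFG : MeasurableSet[S.past s k] (F ∩ G) := MeasurableSet.inter hF hGp
    have h1 := setIntegral_condExp (S.past_le s k) hint hFG
    rw [setIntegral_congr_ae (g := fun _ => c) (S.past_le s k _ hFG), setIntegral_const,
      integral_indicator_const _ hEm] at h1
    · rw [smul_eq_mul, smul_eq_mul, mul_one, measureReal_restrict_apply hEm] at h1
      rw [h1, Set.inter_comm]
    · filter_upwards [hS.markov s k j u hu B hB] with ω hω hωF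
      rw [hω]
      exact hc ω hωF.2
  obtain ⟨q, hq⟩ := hS.homogeneous i j u hu B hB
  have hq1 := hq s k h0
  have huniv : {ω | S.σ i 0 ω = i} = Set.univ := Set.eq_univ_of_forall fun ω => S.σ_zero i ω
  have hq2 := hq i 0 (by rw [huniv]; simp)
  rw [huniv, cond_univ] at hq2
  rw [← hq2, cond_apply hGm] at hq1
  have hGE : P (G ∩ E) = P G * P (S.stepEvent i 0 j u B) := by
    rw [← hq1, ← mul_assoc, ENNReal.mul_inv_cancel h0 (measure_ne_top _ _), one_mul]
  have hcval : c = P.real (S.stepEvent i 0 j u B) := by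
    -- The choice `F = univ` determines `c`, because `P G ≠ 0`.
    have h2 := key Set.univ MeasurableSet.univ
    rw [Set.univ_inter, measureReal_def, hGE, ENNReal.toReal_mul] at h2
    have h3 : (P G).toReal ≠ 0 := ENNReal.toReal_ne_zero.2 ⟨h0, measure_ne_top _ _⟩
    exact (mul_left_cancel₀ h3 h2).symm
  have h4 := key F hF
  rw [hcval, measureReal_def, measureReal_def, measureReal_def, ← ENNReal.toReal_mul] at h4
  exact (ENNReal.toReal_eq_toReal_iff' (measure_ne_top _ _)
    (ENNReal.mul_ne_top (measure_ne_top _ _) (measure_ne_top _ _))).1 h4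

/-- Given the past and the current mode, the next step has the law of an initial step. -/
theorem map_restrict_eq_smul_stepLaw (hS : S.IsSemiMarkov P) (s : Fin N) (k : ℕ) (i j : Fin N)
    {F : Set Ω} (hF : MeasurableSet[S.past s k] F) :
    (P.restrict (F ∩ {ω | S.σ s k ω = i} ∩ {ω | S.σ s (k + 1) ω = j})).map
        (fun ω => (S.h s k ω, S.J s k ω)) =
      P (F ∩ {ω | S.σ s k ω = i}) • S.stepLaw P i j := by
  have hFm : MeasurableSet F := S.past_le s k F hF
  have hGm := S.measurableSet_σ s k i
  have hall : ∀ (B : Set (Matrix (Fin n) (Fin n) ℝ)), MeasurableSet B → ∀ u : ℝ,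
      (P.restrict (F ∩ {ω | S.σ s k ω = i} ∩ {ω | S.σ s (k + 1) ω = j})).map
        (fun ω => (S.h s k ω, S.J s k ω)) (Set.Iic u ×ˢ B) =
      P (F ∩ {ω | S.σ s k ω = i}) • S.stepLaw P i j (Set.Iic u ×ˢ B) := by
    intro B hB u
    have hUB : MeasurableSet (Set.Iic u ×ˢ B) := measurableSet_Iic.prod hB
    rw [stepLaw, Measure.map_apply (S.measurable_h_J s k) hUB,
      Measure.map_apply (S.measurable_h_J i 0) hUB,
      Measure.restrict_apply (S.measurable_h_J s k hUB),
      Measure.restrict_apply (S.measurable_h_J i 0 hUB)]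
    -- The Markov identity is available only for `u ≥ 0`; for negative `u` both events are empty
    -- because dwell times are nonnegative.
    rcases lt_or_ge u 0 with hu | hu
    · have hempty : ∀ s k, (fun ω => (S.h s k ω, S.J s k ω)) ⁻¹' (Set.Iic u ×ˢ B) = ∅ :=
        fun s k => Set.eq_empty_of_forall_notMem fun ω hω =>
          absurd (hω.1 : S.h s k ω ≤ u) (not_le.2 (hu.trans_le (S.h_nonneg s k ω)))
      simp [hempty]
    · rw [smul_eq_mul]
      have h := measure_inter_stepEvent hS s k i j hu hB hF
      convert h using 2
      · ext ω; simp only [stepEvent, Set.mem_inter_iff, Set.mem_preimage, Set.mem_prod,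
          Set.mem_Iic, Set.mem_ofPred_eq]; tauto
      · congr 1
        ext ω; simp only [stepEvent, Set.mem_inter_iff, Set.mem_preimage, Set.mem_prod,
          Set.mem_Iic, Set.mem_ofPred_eq]; tauto
  refine Measure.ext_prod fun {U B} hU hB => ?_
  set μ := (P.restrict (F ∩ {ω | S.σ s k ω = i} ∩ {ω | S.σ s (k + 1) ω = j})).map
        (fun ω => (S.h s k ω, S.J s k ω)) with hμ
  set ν := P (F ∩ {ω | S.σ s k ω = i}) • S.stepLaw P i j with hν
  have hrew : ∀ (ρ : Measure (ℝ × Matrix (Fin n) (Fin n) ℝ)) {U : Set ℝ}, MeasurableSet U →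
      (ρ.restrict (Set.univ ×ˢ B)).map Prod.fst U = ρ (U ×ˢ B) := fun ρ U hU => by
    rw [Measure.map_apply measurable_fst hU, Measure.restrict_apply (measurable_fst hU)]
    congr 1
    ext z; simp
  -- For fixed `B` the half-lines already determine a finite measure on the dwell time axis; this
  -- extends `hall` from half-lines to all Borel `U`.
  have heq : (μ.restrict (Set.univ ×ˢ B)).map Prod.fst =
      (ν.restrict (Set.univ ×ˢ B)).map Prod.fst := by
    refine Measure.ext_of_Iic _ _ fun u => ?_
    rw [hrew μ measurableSet_Iic, hrew ν measurableSet_Iic, hμ, hall B hB u, hν,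
      Measure.smul_apply]
  rw [← hrew μ hU, heq, hrew ν hU]

/-- Given the current mode, past and next step are independent. Indicators of past events are
covered by `map_restrict_eq_smul_stepLaw`; sums and monotone limits give general `Y`. -/
theorem setLIntegral_past_mul_step (hS : S.IsSemiMarkov P) (s : Fin N) (k : ℕ) (i j : Fin N)
    {Y : Ω → ℝ≥0∞} (hY : Measurable[S.past s k] Y)
    {g : ℝ × Matrix (Fin n) (Fin n) ℝ → ℝ≥0∞} (hg : Measurable g) :
    ∫⁻ ω in {ω | S.σ s k ω = i} ∩ {ω | S.σ s (k + 1) ω = j},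
        Y ω * g (S.h s k ω, S.J s k ω) ∂P =
      (∫⁻ ω in {ω | S.σ s k ω = i}, Y ω ∂P) * ∫⁻ z, g z ∂(S.stepLaw P i j) := by
  have hgm : Measurable fun ω => g (S.h s k ω, S.J s k ω) := hg.comp (S.measurable_h_J s k)
  refine @Measurable.ennreal_induction Ω (S.past s k) (fun Y =>
    ∫⁻ ω in {ω | S.σ s k ω = i} ∩ {ω | S.σ s (k + 1) ω = j},
        Y ω * g (S.h s k ω, S.J s k ω) ∂P =
      (∫⁻ ω in {ω | S.σ s k ω = i}, Y ω ∂P) * ∫⁻ z, g z ∂(S.stepLaw P i j)) ?_ ?_ ?_ Y hY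
  · intro c F hF
    have hFm : MeasurableSet F := S.past_le s k F hF
    have h1 : ∀ ω, F.indicator (fun _ => c) ω * g (S.h s k ω, S.J s k ω) =
        F.indicator (fun ω => c * g (S.h s k ω, S.J s k ω)) ω := fun ω => by
      by_cases hω : ω ∈ F <;> simp [hω]
    simp only [h1]
    rw [lintegral_indicator hFm, lintegral_indicator hFm, Measure.restrict_restrict hFm,
      Measure.restrict_restrict hFm, lintegral_const_mul _ hgm, setLIntegral_const,
      ← Set.inter_assoc, ← lintegral_map hg (S.measurable_h_J s k),
      map_restrict_eq_smul_stepLaw hS s k i j hF, lintegral_smul_measure, smul_eq_mul, mul_assoc]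
  · intro f f' _ hf hf' ihf ihf'
    have hfm : Measurable f := hf.mono (S.past_le s k) le_rfl
    simp only [Pi.add_apply, add_mul]
    have hfg : Measurable fun ω => f ω * g (S.h s k ω, S.J s k ω) := hfm.mul hgm
    rw [lintegral_add_left hfg, lintegral_add_left hfm, ihf, ihf', add_mul]
  · intro f hf hmono ih
    have hfm : ∀ l, Measurable (f l) := fun l => (hf l).mono (S.past_le s k) le_rfl
    simp only [ENNReal.iSup_mul]
    have hfg : ∀ l, Measurable fun ω => f l ω * g (S.h s k ω, S.J s k ω) :=
      fun l => (hfm l).mul hgm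
    rw [lintegral_iSup hfg (fun a b hab ω => mul_le_mul_left (hmono hab ω) _), lintegral_iSup hfm hmono,
      ENNReal.iSup_mul]
    simp only [ih]

theorem setLIntegral_past_mul_h (hS : S.IsSemiMarkov P) (s : Fin N) (k : ℕ) (i : Fin N)
    {Y : Ω → ℝ≥0∞} (hY : Measurable[S.past s k] Y) {g : ℝ → ℝ≥0∞} (hg : Measurable g) :
    ∫⁻ ω in {ω | S.σ s k ω = i}, Y ω * g (S.h s k ω) ∂P =
      (∫⁻ ω in {ω | S.σ s k ω = i}, Y ω ∂P) * ∫⁻ ω, g (S.h i 0 ω) ∂P := by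
  have hg' : Measurable fun z : ℝ × Matrix (Fin n) (Fin n) ℝ => g z.1 := hg.comp measurable_fst
  rw [← S.sum_setLIntegral_σ P s (k + 1)]
  simp only [setLIntegral_past_mul_step hS s k i _ hY hg', S.lintegral_stepLaw P _ _ hg']
  rw [← Finset.mul_sum]
  congr 1
  have := S.sum_setLIntegral_σ P i 1 Set.univ fun ω => g (S.h i 0 ω)
  simpa using this

end SwitchedSystem

end SMJLS

/-! ### Spectral radius and decay of matrix powers -/

namespace SMJLS

section Spectral

open scoped Matrix.Norms.Operator

variable {ι : Type*} [Fintype ι] [DecidableEq ι]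

theorem norm_apply_le_norm_map_pow (B : Matrix ι ι ℝ) (k : ℕ) (a b : ι) :
    |(B ^ k) a b| ≤ ‖(B.map (algebraMap ℝ ℂ)) ^ k‖ := by
  have h : (B.map (algebraMap ℝ ℂ)) ^ k = (B ^ k).map (algebraMap ℝ ℂ) :=
    (Matrix.map_pow B (algebraMap ℝ ℂ) k).symm
  rw [h, Matrix.linfty_opNorm_def]
  have h1 : ‖((B ^ k).map (algebraMap ℝ ℂ)) a b‖₊ ≤
      Finset.univ.sup fun i => ∑ j, ‖((B ^ k).map (algebraMap ℝ ℂ)) i j‖₊ :=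
    (Finset.single_le_sum (f := fun j => ‖((B ^ k).map (algebraMap ℝ ℂ)) a j‖₊)
      (fun _ _ => zero_le) (Finset.mem_univ b)).trans
      (Finset.le_sup (f := fun i => ∑ j, ‖((B ^ k).map (algebraMap ℝ ℂ)) i j‖₊)
        (Finset.mem_univ a))
  have h2 := NNReal.coe_le_coe.2 h1
  simpa using h2

/-- The powers of a Schur stable matrix decay geometrically. -/
theorem SchurStable.exists_pow_le {B : Matrix ι ι ℝ} (hB : SchurStable B) :
    ∃ C r : ℝ, 0 < C ∧ 0 < r ∧ r < 1 ∧ ∀ k a b, |(B ^ k) a b| ≤ C * r ^ k := by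
  obtain ⟨q, hq1, hq2⟩ := exists_between hB
  set M := B.map (algebraMap ℝ ℂ) with hM
  -- Gelfand's formula gives `‖M ^ k‖ ≤ q ^ k` for all large `k`; the finitely many remaining powers
  -- are absorbed into `C`.
  have hlim := spectrum.pow_nnnorm_pow_one_div_tendsto_nhds_spectralRadius M
  have hev := (hlim.eventually (gt_mem_nhds hq1)).and (eventually_gt_atTop 0)
  obtain ⟨K, hK⟩ := eventually_atTop.1 hev
  have hqtop : q ≠ ∞ := (hq2.trans ENNReal.one_lt_top).ne
  have hq0 : 0 < q := lt_of_le_of_lt zero_le hq1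
  have hr0 : 0 < q.toReal := ENNReal.toReal_pos hq0.ne' hqtop
  have hr1 : q.toReal < 1 := by
    simpa using (ENNReal.toReal_lt_toReal hqtop ENNReal.one_ne_top).2 hq2
  have hbig : ∀ k, K ≤ k → ‖M ^ k‖ ≤ q.toReal ^ k := fun k hk => by
    obtain ⟨h1, h2⟩ := hK k hk
    have h3 := ENNReal.rpow_le_rpow h1.le (Nat.cast_nonneg (α := ℝ) k)
    rw [← ENNReal.rpow_mul, one_div, inv_mul_cancel₀ (Nat.cast_ne_zero.2 h2.ne'),
      ENNReal.rpow_one, ENNReal.rpow_natCast] at h3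
    have h4 := ENNReal.toReal_mono (ENNReal.pow_ne_top hqtop) h3
    simpa using h4
  set C := 1 + ∑ k ∈ Finset.range K, ‖M ^ k‖ / q.toReal ^ k with hC
  have hC0 : 0 ≤ ∑ k ∈ Finset.range K, ‖M ^ k‖ / q.toReal ^ k :=
    Finset.sum_nonneg fun k _ => by positivity
  refine ⟨C, q.toReal, by linarith, hr0, hr1, fun k a b =>
    (norm_apply_le_norm_map_pow B k a b).trans ?_⟩
  by_cases hk : K ≤ k
  · exact (hbig k hk).trans (le_mul_of_one_le_left (by positivity) (by linarith))
  · rw [← div_le_iff₀ (by positivity)]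
    have h1 : ‖M ^ k‖ / q.toReal ^ k ≤ ∑ k ∈ Finset.range K, ‖M ^ k‖ / q.toReal ^ k :=
      Finset.single_le_sum (f := fun k => ‖M ^ k‖ / q.toReal ^ k)
        (fun k _ => by positivity) (Finset.mem_range.2 (not_le.1 hk))
    linarith

/-- A real matrix whose powers tend to zero entrywise is Schur stable. -/
theorem schurStable_of_tendsto_pow {B : Matrix ι ι ℝ}
    (hB : ∀ a b, Tendsto (fun k => (B ^ k) a b) atTop (𝓝 0)) : SchurStable B := by
  set M := B.map (algebraMap ℝ ℂ) with hM
  have hpow : ∀ k, M ^ k = (B ^ k).map (algebraMap ℝ ℂ) := fun k =>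
    (Matrix.map_pow B (algebraMap ℝ ℂ) k).symm
  have hlim : Tendsto (fun k => M ^ k) atTop (𝓝 0) := by
    refine tendsto_pi_nhds.2 fun a => tendsto_pi_nhds.2 fun b => ?_
    simp only [hpow, Matrix.map_apply]
    have := (Complex.continuous_ofReal.tendsto 0).comp (hB a b)
    rw [Complex.ofReal_zero] at this
    exact this
  -- Only an inequality holds in general: for empty `ι` this norm is `0`.
  have hone : ‖(1 : Matrix ι ι ℂ)‖ ≤ 1 := by
    rw [← Matrix.diagonal_one, Matrix.linfty_opNorm_diagonal, pi_norm_le_iff_of_nonneg zero_le_one]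
    simp
  have hnorm : Tendsto (fun k => ‖M ^ (k + 1)‖) atTop (𝓝 0) :=
    (tendsto_zero_iff_norm_tendsto_zero.1 hlim).comp (tendsto_add_atTop_nat 1)
  -- A single power of norm below `1` already bounds the spectral radius below `1`.
  obtain ⟨k, hk⟩ := (hnorm.eventually (gt_mem_nhds zero_lt_one)).exists
  refine (spectrum.spectralRadius_le_pow_nnnorm_pow_one_div ℂ M k).trans_lt ?_
  have h1 : (‖M ^ (k + 1)‖₊ : ℝ≥0∞) ^ (1 / (k + 1 : ℝ)) < 1 :=
    ENNReal.rpow_lt_one (by exact_mod_cast hk) (by positivity)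
  have h2 : (‖(1 : Matrix ι ι ℂ)‖₊ : ℝ≥0∞) ^ (1 / (k + 1 : ℝ)) ≤ 1 :=
    ENNReal.rpow_le_one (by exact_mod_cast hone) (by positivity)
  calc _ ≤ (‖M ^ (k + 1)‖₊ : ℝ≥0∞) ^ (1 / (k + 1 : ℝ)) * 1 := by gcongr
    _ < 1 := by simpa using h1

end Spectral

end SMJLS

/-! ### Linear recursion of the moments -/

namespace SMJLS

namespace SwitchedSystem

variable {N n : ℕ} {Ω : Type*} [MeasurableSpace Ω] {P : Measure Ω} {S : SwitchedSystem N n Ω}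

theorem ae_stepMat_nonneg (hpos : S.IsPositive P) (s : Fin N) :
    ∀ᵐ ω ∂P, ∀ k a b, 0 ≤ S.stepMat s k ω a b := by
  filter_upwards [ae_all_iff.2 (hpos.nonneg s)] with ω hω k a b
  rw [stepMat, Matrix.mul_apply]
  exact Finset.sum_nonneg fun c _ => mul_nonneg (hω k a c)
    (exp_smul_nonneg_of_metzler (hpos.metzler _) (S.h_nonneg s k ω) c b)

theorem state_succ_apply (S : SwitchedSystem N n Ω) (s : Fin N) (x₀ : EuclideanSpace ℝ (Fin n))
    (k : ℕ) (ω : Ω) (i : Fin n) :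
    S.state s x₀ (k + 1) ω i = ∑ j, S.stepMat s k ω i j * S.state s x₀ k ω j := rfl

theorem ae_state_nonneg (hpos : S.IsPositive P) (s : Fin N) {x₀ : EuclideanSpace ℝ (Fin n)}
    (hx₀ : ∀ i, 0 ≤ x₀ i) : ∀ᵐ ω ∂P, ∀ k i, 0 ≤ S.state s x₀ k ω i := by
  filter_upwards [ae_stepMat_nonneg hpos s] with ω hω k
  induction k with
  | zero => exact hx₀
  | succ k ih =>
    intro i
    rw [state_succ_apply]
    exact Finset.sum_nonneg fun j _ => mul_nonneg (hω k i j) (ih j)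

/-- The entrywise absolute value of a vector. -/
noncomputable def absVec (x : EuclideanSpace ℝ (Fin n)) : EuclideanSpace ℝ (Fin n) :=
  WithLp.toLp 2 fun i => |x i|

theorem norm_absVec (x : EuclideanSpace ℝ (Fin n)) : ‖absVec x‖ = ‖x‖ := by
  simp [EuclideanSpace.norm_eq, absVec]

/-- Nonnegative step matrices preserve entrywise domination, which reduces signed initial states to
nonnegative ones. -/
theorem ae_norm_state_le (hpos : S.IsPositive P) (s : Fin N) (x₀ : EuclideanSpace ℝ (Fin n)) :
    ∀ᵐ ω ∂P, ∀ k, ‖S.state s x₀ k ω‖ ≤ ‖S.state s (absVec x₀) k ω‖ := by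
  filter_upwards [ae_stepMat_nonneg hpos s] with ω hω k
  have h : ∀ i, |S.state s x₀ k ω i| ≤ S.state s (absVec x₀) k ω i := by
    induction k with
    | zero => exact fun i => le_rfl
    | succ k ih =>
      intro i
      rw [state_succ_apply, state_succ_apply]
      refine (Finset.abs_sum_le_sum_abs _ _).trans (Finset.sum_le_sum fun j _ => ?_)
      rw [abs_mul, abs_of_nonneg (hω k i j)]
      exact mul_le_mul_of_nonneg_left (ih j) (hω k i j)
  rw [EuclideanSpace.norm_eq, EuclideanSpace.norm_eq]
  refine Real.sqrt_le_sqrt (Finset.sum_le_sum fun i _ => ?_)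
  exact pow_le_pow_left₀ (norm_nonneg _) ((h i).trans (le_abs_self _)) 2

/-- The `m`-th moments of the state at the `k`-th switching instant, split by mode. -/
noncomputable def moment (S : SwitchedSystem N n Ω) (P : Measure Ω) (m : ℕ) (s : Fin N)
    (x₀ : EuclideanSpace ℝ (Fin n)) (k : ℕ) (a : Fin N × Mon n m) : ℝ≥0∞ :=
  ∫⁻ ω in {ω | S.σ s k ω = a.1}, ENNReal.ofReal (powVec m (S.state s x₀ k ω).ofLp a.2) ∂P

/-- The entries of the block matrix as `[0, ∞]`-valued integrals. -/
noncomputable def stepMoment (S : SwitchedSystem N n Ω) (P : Measure Ω) (m : ℕ)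
    (a b : Fin N × Mon n m) : ℝ≥0∞ :=
  ∫⁻ z, ENNReal.ofReal (powMat m (S.stepFun b.1 z) a.2 b.2) ∂(S.stepLaw P b.1 a.1)

theorem measurable_powMat_stepFun (S : SwitchedSystem N n Ω) (m : ℕ) (i : Fin N) (a b : Mon n m) :
    Measurable fun z => powMat m (S.stepFun i z) a b :=
  (continuous_powMat_apply m a b).measurable.comp (S.measurable_stepFun i)

theorem measurable_past_powVec_state (S : SwitchedSystem N n Ω) (m : ℕ) (s : Fin N)
    (x₀ : EuclideanSpace ℝ (Fin n)) (k : ℕ) (a : Mon n m) :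
    Measurable[S.past s k] fun ω => ENNReal.ofReal (powVec m (S.state s x₀ k ω).ofLp a) := by
  have h : Measurable fun x : EuclideanSpace ℝ (Fin n) => ENNReal.ofReal (powVec m x.ofLp a) :=
    ((continuous_powVec_apply m a).comp (PiLp.continuous_ofLp 2 _)).measurable.ennreal_ofReal
  exact h.comp (S.measurable_past_state s x₀ k)

/-- On `σ_k = i` the new monomials are `powMat` of the step matrix applied to the old ones. The
matrix depends on the next step and the old monomials on the past, so each product factorizes;
nonnegativity makes `[0, ∞]`-valued integrals sufficient. -/
theorem moment_succ [IsProbabilityMeasure P] (hS : S.IsSemiMarkov P) (hpos : S.IsPositive P)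
    (m : ℕ) (s : Fin N) {x₀ : EuclideanSpace ℝ (Fin n)} (hx₀ : ∀ i, 0 ≤ x₀ i) (k : ℕ)
    (a : Fin N × Mon n m) :
    S.moment P m s x₀ (k + 1) a = ∑ b, S.stepMoment P m a b * S.moment P m s x₀ k b := by
  rw [moment, ← S.sum_setLIntegral_σ P s k, Fintype.sum_prod_type]
  refine Finset.sum_congr rfl fun i _ => ?_
  rw [Set.inter_comm]
  have hEm : MeasurableSet ({ω | S.σ s k ω = i} ∩ {ω | S.σ s (k + 1) ω = a.1}) :=
    (S.measurableSet_σ s k i).inter (S.measurableSet_σ s (k + 1) a.1)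
  have hexp : ∀ᵐ ω ∂P, ω ∈ {ω | S.σ s k ω = i} ∩ {ω | S.σ s (k + 1) ω = a.1} →
      ENNReal.ofReal (powVec m (S.state s x₀ (k + 1) ω).ofLp a.2) =
        ∑ b, ENNReal.ofReal (powVec m (S.state s x₀ k ω).ofLp b) *
          ENNReal.ofReal (powMat m (S.stepFun i (S.h s k ω, S.J s k ω)) a.2 b) := by
    filter_upwards [ae_stepMat_nonneg hpos s, ae_state_nonneg hpos s hx₀] with ω h1 h2 hω
    have hstep : S.stepFun i (S.h s k ω, S.J s k ω) = S.stepMat s k ω := by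
      rw [stepMat, show S.σ s k ω = i from hω.1, stepFun]
    rw [hstep, state, Matrix.ofLp_toEuclideanCLM, powMat_mulVec, Matrix.mulVec, dotProduct,
      ENNReal.ofReal_sum_of_nonneg fun b _ =>
        mul_nonneg (powMat_nonneg m (h1 k) a.2 b) (powVec_nonneg m (h2 k) b)]
    refine Finset.sum_congr rfl fun b _ => ?_
    rw [ENNReal.ofReal_mul (powMat_nonneg m (h1 k) a.2 b), mul_comm]
  have hY := S.measurable_past_powVec_state m s x₀ k
  rw [setLIntegral_congr_fun_ae hEm hexp, lintegral_finsetSum]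
  · refine Finset.sum_congr rfl fun b _ => ?_
    rw [setLIntegral_past_mul_step hS s k i a.1 (hY b)
      (measurable_powMat_stepFun S m i a.2 b).ennreal_ofReal, mul_comm]
    rfl
  · exact fun b _ => ((hY b).mono (S.past_le s k) le_rfl).mul
      ((measurable_powMat_stepFun S m i a.2 b).ennreal_ofReal.comp (S.measurable_h_J s k))

theorem stepMoment_eq (S : SwitchedSystem N n Ω) (P : Measure Ω) (m : ℕ)
    (a b : Fin N × Mon n m) :
    S.stepMoment P m a b = ∫⁻ ω in {ω | S.σ b.1 1 ω = a.1},
      ENNReal.ofReal (powMat m (S.stepMat b.1 0 ω) a.2 b.2) ∂P := by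
  rw [stepMoment, S.lintegral_stepLaw P _ _ (measurable_powMat_stepFun S m _ _ _).ennreal_ofReal]
  simp only [stepFun, stepMat, S.σ_zero]

/-- Bounded dwell times and resets bound the integrand. Finiteness ensures that `toReal` loses
nothing when passing to the real block matrix. -/
theorem stepMoment_ne_top [IsProbabilityMeasure P] (hpos : S.IsPositive P) (hbd : S.IsBounded P)
    (m : ℕ) (a b : Fin N × Mon n m) : S.stepMoment P m a b ≠ ∞ := by
  obtain ⟨T, hT, hhT⟩ := hbd.h_le
  obtain ⟨R, hR, hJR⟩ := hbd.J_le
  obtain ⟨K, hK1, hK⟩ := exists_norm_matFlow_le S.A T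
  rw [stepMoment_eq]
  set c : ℝ := (R * K * ‖(WithLp.toLp 2 fun _ => 1 : EuclideanSpace ℝ (Fin n))‖) ^ m /
    powVec m (fun _ => 1) b.2
  have hle : ∀ᵐ ω ∂P, ENNReal.ofReal (powMat m (S.stepMat b.1 0 ω) a.2 b.2) ≤
      ENNReal.ofReal c := by
    filter_upwards [ae_stepMat_nonneg hpos b.1, hhT b.1 0, hJR b.1 0] with ω h1 h2 h3
    refine ENNReal.ofReal_le_ofReal ((powMat_le m (h1 0) a.2 b.2).trans ?_)
    have h4 : ‖Matrix.toEuclideanCLM (𝕜 := ℝ) (S.stepMat b.1 0 ω)‖ ≤ R * K := by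
      rw [toEuclideanCLM_stepMat]
      exact (norm_mul_le _ _).trans (mul_le_mul h3
        (hK _ _ ⟨by linarith [S.h_nonneg b.1 0 ω], h2⟩) (norm_nonneg _) hR.le)
    have h5 := powVec_one_pos m b.2
    simp only [c]
    gcongr
  refine ((lintegral_mono_ae (ae_restrict_of_ae hle)).trans_lt ?_).ne
  rw [setLIntegral_const]
  exact ENNReal.mul_lt_top ENNReal.ofReal_lt_top (measure_lt_top _ _)

/-- The transition probability cancels the normalization of the conditional measure, leaving an
integral over the transition event; if that event is null, both sides vanish. -/
theorem blockMat_eq_toReal [IsProbabilityMeasure P] (hpos : S.IsPositive P) (m : ℕ)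
    (a b : Fin N × Mon n m) : S.blockMat P m a b = (S.stepMoment P m a b).toReal := by
  have huniv : {ω | S.σ b.1 0 ω = b.1} = Set.univ := Set.eq_univ_of_forall fun ω => S.σ_zero b.1 ω
  have hset : {ω | S.σ b.1 0 ω = b.1 ∧ S.σ b.1 1 ω = a.1} = {ω | S.σ b.1 1 ω = a.1} :=
    Set.ext fun ω => and_iff_right (S.σ_zero b.1 ω)
  set E := {ω | S.σ b.1 1 ω = a.1} with hE
  have hmeas : Measurable fun ω => powMat m (S.stepMat b.1 0 ω) a.2 b.2 := by
    have := (measurable_powMat_stepFun S m b.1 a.2 b.2).comp (S.measurable_h_J b.1 0)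
    simpa only [Function.comp_def, stepFun, stepMat, S.σ_zero] using this
  have hint : ∫ ω in E, powMat m (S.stepMat b.1 0 ω) a.2 b.2 ∂P =
      (S.stepMoment P m a b).toReal := by
    rw [stepMoment_eq, integral_eq_lintegral_of_nonneg_ae _ hmeas.aestronglyMeasurable]
    refine ae_restrict_of_ae ?_
    filter_upwards [ae_stepMat_nonneg hpos b.1] with ω hω
    exact powMat_nonneg m (hω 0) a.2 b.2
  rw [← hint, blockMat, Matrix.of_apply, transProb, hset, huniv, cond_univ, ← hE, ProbabilityTheory.cond,
    integral_smul_measure, smul_eq_mul, ← mul_assoc, measureReal_def, ← ENNReal.toReal_mul]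
  by_cases h0 : P E = 0
  · rw [Measure.restrict_eq_zero.2 h0, integral_zero_measure, mul_zero]
  · rw [ENNReal.mul_inv_cancel h0 (measure_ne_top _ _), ENNReal.toReal_one, one_mul]

theorem blockMat_nonneg [IsProbabilityMeasure P] (hpos : S.IsPositive P) (m : ℕ)
    (a b : Fin N × Mon n m) : 0 ≤ S.blockMat P m a b := by
  rw [blockMat_eq_toReal hpos]
  exact ENNReal.toReal_nonneg

theorem blockMat_pow_nonneg [IsProbabilityMeasure P] (hpos : S.IsPositive P) (m k : ℕ)
    (a b : Fin N × Mon n m) : 0 ≤ (S.blockMat P m ^ k) a b := by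
  induction k generalizing a b with
  | zero =>
    rw [pow_zero, Matrix.one_apply]
    split_ifs <;> simp
  | succ k ih =>
    rw [pow_succ, Matrix.mul_apply]
    exact Finset.sum_nonneg fun c _ => mul_nonneg (ih a c) (blockMat_nonneg hpos m c b)

/-- The moment vector at time `0`. -/
noncomputable def initMoment (m : ℕ) (s : Fin N) (x₀ : EuclideanSpace ℝ (Fin n))
    (a : Fin N × Mon n m) : ℝ :=
  if a.1 = s then powVec m x₀.ofLp a.2 else 0

theorem initMoment_nonneg (m : ℕ) (s : Fin N) {x₀ : EuclideanSpace ℝ (Fin n)}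
    (hx₀ : ∀ i, 0 ≤ x₀ i) (a : Fin N × Mon n m) : 0 ≤ initMoment m s x₀ a := by
  unfold initMoment
  split_ifs
  · exact powVec_nonneg m hx₀ _
  · exact le_rfl

theorem initMoment_le (m : ℕ) (s : Fin N) (x₀ : EuclideanSpace ℝ (Fin n))
    (a : Fin N × Mon n m) : initMoment m s x₀ a ≤ ‖x₀‖ ^ m := by
  unfold initMoment
  split_ifs
  · exact powVec_le_norm_pow m x₀ _
  · positivity

theorem moment_eq [IsProbabilityMeasure P] (hS : S.IsSemiMarkov P) (hpos : S.IsPositive P)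
    (hbd : S.IsBounded P) (m : ℕ) (s : Fin N) {x₀ : EuclideanSpace ℝ (Fin n)}
    (hx₀ : ∀ i, 0 ≤ x₀ i) (k : ℕ) (a : Fin N × Mon n m) :
    S.moment P m s x₀ k a =
      ENNReal.ofReal ((S.blockMat P m ^ k).mulVec (initMoment m s x₀) a) := by
  induction k generalizing a with
  | zero =>
    rw [pow_zero, Matrix.one_mulVec, moment, initMoment]
    simp only [S.σ_zero, state]
    by_cases h : a.1 = s
    · simp [h]
    · simp [h, Ne.symm h]
  | succ k ih =>
    have hv : ∀ b, 0 ≤ (S.blockMat P m ^ k).mulVec (initMoment m s x₀) b := fun b =>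
      Finset.sum_nonneg fun c _ =>
        mul_nonneg (blockMat_pow_nonneg hpos m k b c) (initMoment_nonneg m s hx₀ c)
    rw [moment_succ hS hpos m s hx₀, pow_succ', ← Matrix.mulVec_mulVec, Matrix.mulVec,
      dotProduct, ENNReal.ofReal_sum_of_nonneg fun b _ =>
        mul_nonneg (blockMat_nonneg hpos m a b) (hv b)]
    refine Finset.sum_congr rfl fun b _ => ?_
    rw [ih, ENNReal.ofReal_mul (blockMat_nonneg hpos m a b), blockMat_eq_toReal hpos,
      ENNReal.ofReal_toReal (stepMoment_ne_top hpos hbd m a b)]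

theorem moment_le_lintegral_norm (S : SwitchedSystem N n Ω) (P : Measure Ω) (m : ℕ) (s : Fin N)
    (x₀ : EuclideanSpace ℝ (Fin n)) (k : ℕ) (a : Fin N × Mon n m) :
    S.moment P m s x₀ k a ≤ ∫⁻ ω, ENNReal.ofReal (‖S.state s x₀ k ω‖ ^ m) ∂P :=
  (setLIntegral_le_lintegral _ _).trans
    (lintegral_mono fun _ => ENNReal.ofReal_le_ofReal (powVec_le_norm_pow m _ a.2))

theorem lintegral_norm_le_sum_moment (hpos : S.IsPositive P) (m : ℕ) (s : Fin N)
    {x₀ : EuclideanSpace ℝ (Fin n)} (hx₀ : ∀ i, 0 ≤ x₀ i) (k : ℕ) :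
    ∫⁻ ω, ENNReal.ofReal (‖S.state s x₀ k ω‖ ^ m) ∂P ≤ ∑ a, S.moment P m s x₀ k a := by
  have hm : ∀ a : Mon n m, Measurable fun ω =>
      ENNReal.ofReal (powVec m (S.state s x₀ k ω).ofLp a) := fun a =>
    (S.measurable_past_powVec_state m s x₀ k a).mono (S.past_le s k) le_rfl
  calc _ ≤ ∫⁻ ω, ∑ a, ENNReal.ofReal (powVec m (S.state s x₀ k ω).ofLp a) ∂P := by
        refine lintegral_mono_ae ?_
        filter_upwards [ae_state_nonneg hpos s hx₀] with ω hω
        rw [← ENNReal.ofReal_sum_of_nonneg fun a _ => powVec_nonneg m (hω k) a]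
        exact ENNReal.ofReal_le_ofReal (norm_pow_le_sum_powVec m _ (hω k))
    _ = ∑ a, ∫⁻ ω, ENNReal.ofReal (powVec m (S.state s x₀ k ω).ofLp a) ∂P :=
        lintegral_finsetSum _ fun a _ => hm a
    _ = ∑ a, S.moment P m s x₀ k a := by
        rw [Fintype.sum_prod_type_right]
        refine Finset.sum_congr rfl fun a _ => ?_
        have := S.sum_setLIntegral_σ P s k Set.univ
          fun ω => ENNReal.ofReal (powVec m (S.state s x₀ k ω).ofLp a)
        rw [Measure.restrict_univ] at this
        rw [← this]
        simp only [Set.univ_inter, moment]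

/-- Geometric decay of the `m`-th mean at the switching instants. -/
theorem exists_lintegral_norm_state_le [IsProbabilityMeasure P] (hS : S.IsSemiMarkov P)
    (hpos : S.IsPositive P) (hbd : S.IsBounded P) (m : ℕ) (hB : SchurStable (S.blockMat P m)) :
    ∃ C r : ℝ, 0 < C ∧ 0 < r ∧ r < 1 ∧ ∀ (s : Fin N) (x₀ : EuclideanSpace ℝ (Fin n)) (k : ℕ),
      ∫⁻ ω, ENNReal.ofReal (‖S.state s x₀ k ω‖ ^ m) ∂P ≤
        ENNReal.ofReal (C * r ^ k * ‖x₀‖ ^ m) := by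
  obtain ⟨C, r, hC, hr0, hr1, hCr⟩ := hB.exists_pow_le
  set d : ℝ := (Fintype.card (Fin N × Mon n m) : ℝ) with hd
  -- One factor `d` comes from the sum in the matrix-vector product, the other from adding all
  -- coordinates; the `+ 1` keeps the constant positive when there are no coordinates.
  refine ⟨d * (d * C) + 1, r, by positivity, hr0, hr1, fun s x₀ k => ?_⟩
  have habs : ∀ i, 0 ≤ absVec x₀ i := fun i => abs_nonneg _
  have hent : ∀ a, (S.blockMat P m ^ k).mulVec (initMoment m s (absVec x₀)) a ≤
      d * (C * r ^ k * ‖x₀‖ ^ m) := fun a => by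
    rw [Matrix.mulVec, dotProduct, hd, ← nsmul_eq_mul, ← Finset.card_univ]
    refine Finset.sum_le_card_nsmul _ _ _ fun b _ => ?_
    refine mul_le_mul ((le_abs_self _).trans (hCr k a b)) ?_
      (initMoment_nonneg m s habs b) (by positivity)
    rw [← norm_absVec]
    exact initMoment_le m s _ b
  calc _ ≤ ∫⁻ ω, ENNReal.ofReal (‖S.state s (absVec x₀) k ω‖ ^ m) ∂P := by
        refine lintegral_mono_ae ?_
        filter_upwards [ae_norm_state_le hpos s x₀] with ω hω
        exact ENNReal.ofReal_le_ofReal (pow_le_pow_left₀ (norm_nonneg _) (hω k) m)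
    _ ≤ ∑ a, S.moment P m s (absVec x₀) k a := lintegral_norm_le_sum_moment hpos m s habs k
    _ ≤ ∑ _a : Fin N × Mon n m, ENNReal.ofReal (d * (C * r ^ k * ‖x₀‖ ^ m)) := by
        refine Finset.sum_le_sum fun a _ => ?_
        rw [moment_eq hS hpos hbd m s habs]
        exact ENNReal.ofReal_le_ofReal (hent a)
    _ = ENNReal.ofReal (d * (d * (C * r ^ k * ‖x₀‖ ^ m))) := by
        rw [Finset.sum_const, Finset.card_univ, nsmul_eq_mul, ← ENNReal.ofReal_natCast,
          ← ENNReal.ofReal_mul (Nat.cast_nonneg _)]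
    _ ≤ _ := by
        refine ENNReal.ofReal_le_ofReal ?_
        have : 0 ≤ r ^ k * ‖x₀‖ ^ m := by positivity
        nlinarith

end SwitchedSystem

end SMJLS

/-! ### Between switching instants and continuous time -/

namespace SMJLS

namespace SwitchedSystem

variable {N n : ℕ} {Ω : Type*} [MeasurableSpace Ω] {P : Measure Ω} {S : SwitchedSystem N n Ω}

/-- Each mode has `E[exp (-h)] < 1` because its dwell time is positive. The Markov property
multiplies these factors, and `ρ` is the largest over the finitely many modes. -/
theorem exists_lintegral_exp_neg_t_le [IsProbabilityMeasure P] (hS : S.IsSemiMarkov P)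
    (hbd : S.IsBounded P) (s : Fin N) :
    ∃ ρ : ℝ≥0∞, ρ < 1 ∧ ∀ k, ∫⁻ ω, ENNReal.ofReal (Real.exp (-S.t s k ω)) ∂P ≤ ρ ^ k := by
  have hexp : Measurable fun x : ℝ => ENNReal.ofReal (Real.exp (-x)) := by fun_prop
  have hlt : ∀ i : Fin N, ∫⁻ ω, ENNReal.ofReal (Real.exp (-S.h i 0 ω)) ∂P < 1 := fun i => by
    have hlt1 : ∀ᵐ ω ∂P, ENNReal.ofReal (Real.exp (-S.h i 0 ω)) < 1 := by
      filter_upwards [hbd.h_pos i 0] with ω hω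
      rw [ENNReal.ofReal_lt_one, Real.exp_lt_one_iff]
      linarith
    have h1 : ∫⁻ _ω : Ω, (1 : ℝ≥0∞) ∂P = 1 := by simp
    rw [← h1]
    refine lintegral_strict_mono (IsProbabilityMeasure.ne_zero P) aemeasurable_const ?_ hlt1
    refine ((lintegral_mono_ae (hlt1.mono fun _ h => h.le)).trans_lt ?_).ne
    rw [h1]
    exact ENNReal.one_lt_top
  refine ⟨Finset.univ.sup fun i => ∫⁻ ω, ENNReal.ofReal (Real.exp (-S.h i 0 ω)) ∂P,
    (Finset.sup_lt_iff (by simp)).2 fun i _ => hlt i, fun k => ?_⟩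
  set ρ := Finset.univ.sup fun i => ∫⁻ ω, ENNReal.ofReal (Real.exp (-S.h i 0 ω)) ∂P
  induction k with
  | zero => simp [S.t_zero]
  | succ k ih =>
    have hY : Measurable[S.past s k] fun ω => ENNReal.ofReal (Real.exp (-S.t s k ω)) :=
      hexp.comp (S.measurable_past_t s le_rfl)
    have hsplit : ∀ ω, ENNReal.ofReal (Real.exp (-S.t s (k + 1) ω)) =
        ENNReal.ofReal (Real.exp (-S.t s k ω)) * ENNReal.ofReal (Real.exp (-S.h s k ω)) :=
      fun ω => by
        rw [← ENNReal.ofReal_mul (Real.exp_pos _).le, ← Real.exp_add, h]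
        congr 2
        ring
    have hsum := fun f : Ω → ℝ≥0∞ => S.sum_setLIntegral_σ P s k Set.univ f
    simp only [Set.univ_inter, Measure.restrict_univ] at hsum
    simp only [hsplit]
    rw [← hsum]
    calc _ = ∑ i, (∫⁻ ω in {ω | S.σ s k ω = i}, ENNReal.ofReal (Real.exp (-S.t s k ω)) ∂P) *
          ∫⁻ ω, ENNReal.ofReal (Real.exp (-S.h i 0 ω)) ∂P :=
          Finset.sum_congr rfl fun i _ => setLIntegral_past_mul_h hS s k i hY hexp
      _ ≤ ∑ i, (∫⁻ ω in {ω | S.σ s k ω = i}, ENNReal.ofReal (Real.exp (-S.t s k ω)) ∂P) * ρ := by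
          refine Finset.sum_le_sum fun i _ => mul_le_mul_right ?_ _
          exact Finset.le_sup (f := fun i => ∫⁻ ω, ENNReal.ofReal (Real.exp (-S.h i 0 ω)) ∂P)
            (Finset.mem_univ i)
      _ ≤ ρ ^ (k + 1) := by
          rw [← Finset.sum_mul, hsum, pow_succ]
          gcongr

/-- The switching instants do not accumulate. -/
theorem ae_exists_lt_t [IsProbabilityMeasure P] (hS : S.IsSemiMarkov P)
    (hbd : S.IsBounded P) (s : Fin N) (u : ℝ) : ∀ᵐ ω ∂P, ∃ k, u < S.t s k ω := by
  obtain ⟨ρ, hρ, hle⟩ := exists_lintegral_exp_neg_t_le hS hbd s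
  have hc : ENNReal.ofReal (Real.exp (-u)) ≠ 0 := (ENNReal.ofReal_pos.2 (Real.exp_pos _)).ne'
  have hbound : ∀ k, P {ω | ¬∃ k, u < S.t s k ω} ≤ ρ ^ k / ENNReal.ofReal (Real.exp (-u)) := by
    intro k
    -- Markov's inequality: if no switching instant exceeds `u`, then `exp (-t_k) ≥ exp (-u)` for
    -- every `k`.
    refine (measure_mono ?_).trans ((meas_ge_le_lintegral_div
      (f := fun ω => ENNReal.ofReal (Real.exp (-S.t s k ω)))
      (((S.measurable_t s k).neg.exp).ennreal_ofReal).aemeasurable hc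
      ENNReal.ofReal_ne_top).trans (ENNReal.div_le_div_right (hle k) _))
    intro ω hω
    refine ENNReal.ofReal_le_ofReal (Real.exp_le_exp.2 (neg_le_neg ?_))
    exact not_lt.1 fun h => hω ⟨k, h⟩
  have hlim : Tendsto (fun k => ρ ^ k / ENNReal.ofReal (Real.exp (-u))) atTop (𝓝 0) := by
    have := ENNReal.Tendsto.div_const (ENNReal.tendsto_pow_atTop_nhds_zero_of_lt_one hρ)
      (b := ENNReal.ofReal (Real.exp (-u))) (Or.inr hc)
    simpa using this
  exact le_antisymm (ge_of_tendsto' hlim hbound) zero_le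

theorem exists_mem_Ico_t (S : SwitchedSystem N n Ω) {s : Fin N} {u : ℝ} {ω : Ω} (hu : 0 ≤ u)
    (h : ∃ k, u < S.t s k ω) : ∃ k, u ∈ Set.Ico (S.t s k ω) (S.t s (k + 1) ω) := by
  classical
  have hpos : Nat.find h ≠ 0 := fun h0 => by
    have h1 := Nat.find_spec h
    rw [h0, S.t_zero] at h1
    exact absurd h1 (not_lt.2 hu)
  obtain ⟨k, hk⟩ := Nat.exists_eq_succ_of_ne_zero hpos
  refine ⟨k, not_lt.1 (Nat.find_min h (hk ▸ k.lt_succ_self)), ?_⟩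
  have h1 := Nat.find_spec h
  rwa [hk] at h1

theorem ae_t_le {T : ℝ} {s : Fin N} (hT : ∀ k, ∀ᵐ ω ∂P, S.h s k ω ≤ T) :
    ∀ᵐ ω ∂P, ∀ k : ℕ, S.t s k ω ≤ k * T := by
  filter_upwards [ae_all_iff.2 hT] with ω hω k
  induction k with
  | zero => simp [S.t_zero]
  | succ k ih =>
    have := hω k
    rw [h] at this
    push_cast
    linarith

theorem expMeanStable_of_schurStable [IsProbabilityMeasure P] (hS : S.IsSemiMarkov P)
    (hpos : S.IsPositive P) (hbd : S.IsBounded P) (m : ℕ) (hB : SchurStable (S.blockMat P m)) :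
    S.ExpMeanStable P m := by
  obtain ⟨C, r, hC, hr0, hr1, hCr⟩ := exists_lintegral_norm_state_le hS hpos hbd m hB
  obtain ⟨T, hT, hhT⟩ := hbd.h_le
  obtain ⟨K, hK1, hK⟩ := exists_norm_matFlow_le S.A T
  have hlog : Real.log r < 0 := Real.log_neg hr0 hr1
  have hK0 : 0 < K := zero_lt_one.trans_le hK1
  have hr1' : 0 < 1 - r := sub_pos.2 hr1
  -- The rate comes from `r ^ (u / T) = exp (-β * u)`. The factor `K ^ m` pays for the flow inside
  -- an interval, `(1 - r)⁻¹` for the sum over indices, and `1 / r` for rounding `u / T` down.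
  refine ⟨K ^ m * (C * (1 - r)⁻¹) / r, -Real.log r / T, by positivity,
    div_pos (neg_pos.2 hlog) hT, fun s x₀ x hx u hu => ?_⟩
  set k₀ := ⌊u / T⌋₊
  -- The random index of the interval containing `u` is at least `k₀`, as `t_k ≤ k * T`; summing
  -- over all candidates removes the dependence on `ω`.
  have hpt : ∀ᵐ ω ∂P, ENNReal.ofReal (‖x u ω‖ ^ m) ≤
      ∑' l, ENNReal.ofReal (K ^ m) * ENNReal.ofReal (‖S.state s x₀ (l + k₀) ω‖ ^ m) := by
    filter_upwards [hx, ae_h_pos hbd s, ae_exists_lt_t hS hbd s u, ae_t_le (hhT s),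
      ae_all_iff.2 (hhT s)] with ω h1 h2 h3 h4 h5
    obtain ⟨k, hk⟩ := S.exists_mem_Ico_t hu h3
    have hkk : k₀ ≤ k := by
      refine Nat.lt_succ_iff.1 ((Nat.floor_lt (by positivity)).2 ?_)
      rw [div_lt_iff₀ hT]
      exact hk.2.trans_le (h4 (k + 1))
    have hnorm : ‖x u ω‖ ≤ K * ‖S.state s x₀ k ω‖ := by
      rw [h1.eq_flow h2 hk]
      refine (ContinuousLinearMap.le_opNorm _ _).trans
        (mul_le_mul_of_nonneg_right (hK _ _ ⟨?_, ?_⟩) (norm_nonneg _))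
      · linarith [hk.1]
      · have := h5 k
        rw [h] at this
        linarith [hk.2]
    calc _ ≤ ENNReal.ofReal ((K * ‖S.state s x₀ k ω‖) ^ m) :=
          ENNReal.ofReal_le_ofReal (pow_le_pow_left₀ (norm_nonneg _) hnorm m)
      _ = ENNReal.ofReal (K ^ m) * ENNReal.ofReal (‖S.state s x₀ (k - k₀ + k₀) ω‖ ^ m) := by
          rw [Nat.sub_add_cancel hkk, mul_pow, ENNReal.ofReal_mul (by positivity)]
      _ ≤ _ := ENNReal.le_tsum (k - k₀)
  have hmeas : ∀ k, Measurable fun ω => ENNReal.ofReal (‖S.state s x₀ k ω‖ ^ m) := fun k =>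
    ((S.measurable_state s x₀ k).norm.pow_const m).ennreal_ofReal
  have hgeom : HasSum (fun l => K ^ m * (C * r ^ (l + k₀) * ‖x₀‖ ^ m))
      (K ^ m * (C * r ^ k₀ * ‖x₀‖ ^ m) * (1 - r)⁻¹) := by
    refine ((hasSum_geometric_of_lt_one hr0.le hr1).mul_left
      (K ^ m * (C * r ^ k₀ * ‖x₀‖ ^ m))).congr_fun ?_
    intro l
    rw [pow_add]
    ring
  have hrk : r ^ k₀ ≤ Real.exp (-(-Real.log r / T) * u) / r := by
    rw [le_div_iff₀ hr0, ← pow_succ, ← Real.rpow_natCast, Real.rpow_def_of_pos hr0,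
      Real.exp_le_exp]
    have h1 : u / T < k₀ + 1 := Nat.lt_floor_add_one _
    have h2 : -(-Real.log r / T) * u = Real.log r * (u / T) := by ring
    rw [h2]
    push_cast
    exact mul_le_mul_of_nonpos_left h1.le hlog.le
  calc _ ≤ ∫⁻ ω, ∑' l, ENNReal.ofReal (K ^ m) *
        ENNReal.ofReal (‖S.state s x₀ (l + k₀) ω‖ ^ m) ∂P := lintegral_mono_ae hpt
    _ = ∑' l, ENNReal.ofReal (K ^ m) *
        ∫⁻ ω, ENNReal.ofReal (‖S.state s x₀ (l + k₀) ω‖ ^ m) ∂P := by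
        rw [lintegral_tsum fun l => ((hmeas _).const_mul _).aemeasurable]
        simp only [lintegral_const_mul _ (hmeas _)]
    _ ≤ ∑' l, ENNReal.ofReal (K ^ m * (C * r ^ (l + k₀) * ‖x₀‖ ^ m)) := by
        refine ENNReal.tsum_le_tsum fun l => ?_
        rw [ENNReal.ofReal_mul (by positivity)]
        gcongr
        exact hCr s x₀ _
    _ = ENNReal.ofReal (K ^ m * (C * r ^ k₀ * ‖x₀‖ ^ m) * (1 - r)⁻¹) := by
        rw [← hgeom.tsum_eq, ENNReal.ofReal_tsum_of_nonneg (fun l => by positivity)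
          hgeom.summable]
    _ ≤ _ := by
        refine ENNReal.ofReal_le_ofReal ?_
        calc _ ≤ K ^ m * (C * (Real.exp (-(-Real.log r / T) * u) / r) * ‖x₀‖ ^ m) *
              (1 - r)⁻¹ := by gcongr
          _ = _ := by ring

/-- The time integral of the `m`-th mean is finite by stability and, by Tonelli, dominates a
multiple of the weighted sum of `E[‖x_k‖^m h_k]`. The weights `h_k` are then replaced by their
conditional means given the mode. -/
theorem summable_lintegral_norm_state [IsProbabilityMeasure P] (hS : S.IsSemiMarkov P)
    (hbd : S.IsBounded P) {m : ℕ} (hst : S.ExpMeanStable P m) (s : Fin N)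
    (x₀ : EuclideanSpace ℝ (Fin n)) :
    ∑' k, ∫⁻ ω, ENNReal.ofReal (‖S.state s x₀ k ω‖ ^ m) ∂P ≠ ∞ := by
  obtain ⟨C, β, hC, hβ, hle⟩ := hst
  obtain ⟨T, hT, hhT⟩ := hbd.h_le
  obtain ⟨K, hK1, hK⟩ := exists_norm_matFlow_le S.A T
  have hK0 : 0 < K := zero_lt_one.trans_le hK1
  set x := S.trajectory s x₀ with hx
  have hxt := hle s x₀ x (isTrajectory_trajectory hbd s x₀)
  set Y : ℕ → Ω → ℝ≥0∞ := fun k ω => ENNReal.ofReal (‖S.state s x₀ k ω‖ ^ m) with hY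
  have hYp : ∀ k, Measurable[S.past s k] (Y k) := fun k => by
    have h : Measurable fun x : EuclideanSpace ℝ (Fin n) => ENNReal.ofReal (‖x‖ ^ m) := by fun_prop
    exact h.comp (S.measurable_past_state s x₀ k)
  have hYm : ∀ k, Measurable (Y k) := fun k => (hYp k).mono (S.past_le s k) le_rfl
  set D : ℕ → Set (ℝ × Ω) := fun k => {p | S.t s k p.2 ≤ p.1 ∧ p.1 < S.t s (k + 1) p.2} with hD
  have hDm : ∀ k, MeasurableSet (D k) := fun k =>
    (measurableSet_le ((S.measurable_t s k).comp measurable_snd) measurable_fst).inter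
      (measurableSet_lt measurable_fst ((S.measurable_t s (k + 1)).comp measurable_snd))
  set Z : ℕ → ℝ × Ω → ℝ≥0∞ := fun k => (D k).indicator fun p => Y k p.2 with hZ
  have hZm : ∀ k, Measurable (Z k) := fun k =>
    ((hYm k).comp measurable_snd).indicator (hDm k)
  have hpt : ∀ u : ℝ, ∀ᵐ ω ∂P, ∑' k, Z k (u, ω) ≤
      ENNReal.ofReal (K ^ m) * ENNReal.ofReal (‖x u ω‖ ^ m) := by
    intro u
    filter_upwards [ae_all_iff.2 (hhT s)] with ω hω
    by_cases hex : ∃ k, u ∈ Set.Ico (S.t s k ω) (S.t s (k + 1) ω)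
    · obtain ⟨k, hk⟩ := hex
      have hne : ∀ l, l ≠ k → Z l (u, ω) = 0 := fun l hl => by
        refine Set.indicator_of_notMem (fun hmem => hl ?_) _
        refine le_antisymm (Nat.lt_succ_iff.1 ((S.t_mono s ω).reflect_lt ?_))
          (Nat.lt_succ_iff.1 ((S.t_mono s ω).reflect_lt ?_))
        · exact hmem.1.trans_lt hk.2
        · exact hk.1.trans_lt hmem.2
      have hZk : Z k (u, ω) = Y k ω :=
        Set.indicator_of_mem (show (u, ω) ∈ D k from hk) fun p : ℝ × Ω => Y k p.2
      rw [tsum_eq_single k hne, hZk, ← ENNReal.ofReal_mul (by positivity), ← mul_pow]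
      refine ENNReal.ofReal_le_ofReal (pow_le_pow_left₀ (norm_nonneg _) ?_ m)
      rw [hx, S.trajectory_eq s x₀ hk]
      -- Running the flow backwards bounds the state at `t_k` by the state at `u`; hence the bound
      -- `K` on negative times as well.
      nth_rewrite 1 [← matFlow_neg_apply_matFlow (S.A (S.σ s k ω)) (u - S.t s k ω)
        (S.state s x₀ k ω)]
      refine (ContinuousLinearMap.le_opNorm _ _).trans
        (mul_le_mul_of_nonneg_right (hK _ _ ⟨?_, ?_⟩) (norm_nonneg _))
      · have := hω k
        rw [h] at this
        linarith [hk.2]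
      · linarith [hk.1]
    -- Times outside every interval contribute nothing, so accumulation of switching instants is
    -- harmless here.
    · have hz : ∀ k, Z k (u, ω) = 0 := fun k =>
        Set.indicator_of_notMem (s := D k) (fun hmem => hex ⟨k, hmem⟩) fun p : ℝ × Ω => Y k p.2
      simp [hz]
  have hfin : ∫⁻ u in Set.Ici (0 : ℝ), ∫⁻ ω, ∑' k, Z k (u, ω) ∂P < ∞ := by
    have hint : IntegrableOn (fun u => K ^ m * (C * Real.exp (-β * u) * ‖x₀‖ ^ m))
        (Set.Ici (0 : ℝ)) := by
      rw [integrableOn_Ici_iff_integrableOn_Ioi]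
      exact (((exp_neg_integrableOn_Ioi 0 hβ).const_mul C).mul_const _).const_mul _
    refine lt_of_le_of_lt ?_ hint.lintegral_lt_top
    refine setLIntegral_mono' measurableSet_Ici fun u hu => ?_
    calc _ ≤ ∫⁻ ω, ENNReal.ofReal (K ^ m) * ENNReal.ofReal (‖x u ω‖ ^ m) ∂P :=
          lintegral_mono_ae (hpt u)
      _ = ENNReal.ofReal (K ^ m) * ∫⁻ ω, ENNReal.ofReal (‖x u ω‖ ^ m) ∂P :=
          lintegral_const_mul' _ _ ENNReal.ofReal_ne_top
      _ ≤ _ := by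
          rw [ENNReal.ofReal_mul (by positivity)]
          gcongr
          exact hxt u hu
  have hinner : ∀ k ω, ∫⁻ u in Set.Ici (0 : ℝ), Z k (u, ω) =
      Y k ω * ENNReal.ofReal (S.h s k ω) := by
    intro k ω
    have hz : (fun u => Z k (u, ω)) =
        (Set.Ico (S.t s k ω) (S.t s (k + 1) ω)).indicator fun _ => Y k ω := rfl
    have h0 : 0 ≤ S.t s k ω := by
      have := S.t_mono s ω (Nat.zero_le k)
      simpa only [S.t_zero] using this
    have hsub : Set.Ico (S.t s k ω) (S.t s (k + 1) ω) ⊆ Set.Ici 0 := fun u hu => h0.trans hu.1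
    rw [hz, lintegral_indicator_const measurableSet_Ico, Measure.restrict_apply measurableSet_Ico,
      Set.inter_eq_left.2 hsub, Real.volume_Ico, h]
  have hswap : ∫⁻ u in Set.Ici (0 : ℝ), ∫⁻ ω, ∑' k, Z k (u, ω) ∂P =
      ∑' k, ∫⁻ ω, Y k ω * ENNReal.ofReal (S.h s k ω) ∂P := by
    rw [lintegral_lintegral_swap (f := fun u ω => ∑' k, Z k (u, ω))
      (Measurable.tsum hZm).aemeasurable]
    have hin : ∀ ω, ∫⁻ u in Set.Ici (0 : ℝ), ∑' k, Z k (u, ω) =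
        ∑' k, ∫⁻ u in Set.Ici (0 : ℝ), Z k (u, ω) := fun ω =>
      lintegral_tsum fun k =>
        ((hZm k).comp (measurable_id.prodMk measurable_const)).aemeasurable
    simp only [hin]
    rw [lintegral_tsum]
    · simp only [hinner]
    · intro k
      simp only [hinner]
      exact ((hYm k).mul (S.measurable_h s k).ennreal_ofReal).aemeasurable
  -- The least mean dwell time, positive because there are finitely many modes and dwell times are
  -- almost surely positive.
  set δ := Finset.univ.inf fun i => ∫⁻ ω, ENNReal.ofReal (S.h i 0 ω) ∂P with hδ
  have hδ0 : 0 < δ := by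
    refine (Finset.lt_inf_iff ENNReal.zero_lt_top).2 fun i _ => pos_iff_ne_zero.2 fun h0 => ?_
    rw [lintegral_eq_zero_iff (S.measurable_h i 0).ennreal_ofReal] at h0
    obtain ⟨ω, hω1, hω2⟩ := (h0.and (hbd.h_pos i 0)).exists
    exact absurd hω1 (ENNReal.ofReal_pos.2 hω2).ne'
  have hlow : ∀ k, δ * ∫⁻ ω, Y k ω ∂P ≤ ∫⁻ ω, Y k ω * ENNReal.ofReal (S.h s k ω) ∂P := by
    intro k
    have hsum := fun f : Ω → ℝ≥0∞ => S.sum_setLIntegral_σ P s k Set.univ f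
    simp only [Set.univ_inter, Measure.restrict_univ] at hsum
    rw [← hsum, ← hsum, Finset.mul_sum]
    refine Finset.sum_le_sum fun i _ => ?_
    rw [setLIntegral_past_mul_h hS s k i (hYp k) ENNReal.measurable_ofReal, mul_comm]
    gcongr
    exact Finset.inf_le (Finset.mem_univ i)
  have htot : δ * ∑' k, ∫⁻ ω, Y k ω ∂P < ∞ := by
    rw [← ENNReal.tsum_mul_left]
    exact (ENNReal.tsum_le_tsum hlow).trans_lt (hswap ▸ hfin)
  intro htop
  rw [htop, ENNReal.mul_top hδ0.ne'] at htot
  exact lt_irrefl _ htot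

/-- Starting in mode `b.1` from the all-ones vector, the initial moment at `b` is positive. All
terms of the matrix-vector product being nonnegative, the vanishing moment at `a` dominates a fixed
positive multiple of the `(a, b)` entry of the power. -/
theorem schurStable_of_expMeanStable [IsProbabilityMeasure P] (hS : S.IsSemiMarkov P)
    (hpos : S.IsPositive P) (hbd : S.IsBounded P) {m : ℕ} (hst : S.ExpMeanStable P m) :
    SchurStable (S.blockMat P m) := by
  refine schurStable_of_tendsto_pow fun a b => ?_
  set e : EuclideanSpace ℝ (Fin n) := WithLp.toLp 2 fun _ => 1 with he
  have he0 : ∀ i, 0 ≤ e i := fun _ => zero_le_one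
  have hb : 0 < initMoment m b.1 e b := by
    rw [initMoment, if_pos rfl]
    exact powVec_one_pos m b.2
  have h1 := ENNReal.tendsto_atTop_zero_of_tsum_ne_top
    (summable_lintegral_norm_state hS hbd hst b.1 e)
  have h2 : Tendsto (fun k => S.moment P m b.1 e k a) atTop (𝓝 0) :=
    tendsto_of_tendsto_of_tendsto_of_le_of_le tendsto_const_nhds h1 (fun _ => zero_le)
      fun k => S.moment_le_lintegral_norm P m b.1 e k a
  have h3 := (ENNReal.tendsto_toReal ENNReal.zero_ne_top).comp h2
  have hterm : ∀ k c, 0 ≤ (S.blockMat P m ^ k) a c * initMoment m b.1 e c := fun k c =>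
    mul_nonneg (blockMat_pow_nonneg hpos m k a c) (initMoment_nonneg m b.1 he0 c)
  have h4 : Tendsto (fun k => (S.blockMat P m ^ k) a b * initMoment m b.1 e b) atTop (𝓝 0) := by
    refine tendsto_of_tendsto_of_tendsto_of_le_of_le tendsto_const_nhds h3
      (fun k => hterm k b) fun k => ?_
    have hk : (S.blockMat P m ^ k).mulVec (initMoment m b.1 e) a =
      ∑ c, (S.blockMat P m ^ k) a c * initMoment m b.1 e c := rfl
    rw [Function.comp_apply, moment_eq hS hpos hbd m b.1 he0, hk,
      ENNReal.toReal_ofReal (Finset.sum_nonneg fun c _ => hterm k c)]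
    exact Finset.single_le_sum (f := fun c => (S.blockMat P m ^ k) a c * initMoment m b.1 e c)
      (fun c _ => hterm k c) (Finset.mem_univ b)
  simpa [hb.ne'] using h4.div_const (initMoment m b.1 e b)

end SwitchedSystem

end SMJLS

theorem theorem2p3 {N n : ℕ} {Ω : Type*} [MeasurableSpace Ω] (P : Measure Ω)
    [IsProbabilityMeasure P] (S : SMJLS.SwitchedSystem N n Ω) (hsm : S.IsSemiMarkov P)
    (hpos : S.IsPositive P) (hbd : S.IsBounded P) (m : ℕ) (hm : 0 < m) :
    S.ExpMeanStable P m ↔ SMJLS.SchurStable (S.blockMat P m) :=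
  ⟨SMJLS.SwitchedSystem.schurStable_of_expMeanStable hsm hpos hbd,
    SMJLS.SwitchedSystem.expMeanStable_of_schurStable hsm hpos hbd m⟩
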